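/- Let $H$ be a separable complex Hilbert space (inner product conjugate linear in the first argument) and let $T$ be a closed, simple, regular, symmetric linear transformation in $H$ with deficiency indices $(1,1)$, not necessarily densely defined. Here simple means that there is no non-trivial proper closed subspace $S$ such that the restriction of $T$ to $\operatorname{dom}T\cap S$ is self-adjoint in $S$; regular means that $T-t$ is bounded below on $\operatorname{dom} T$ for every $t\in\mathbb R$. Fix nonzero vectors of equal norm $\varphi_+\in\operatorname{ran}(T+i)^\perp=\ker(T^*-i)$ and $\varphi_-\in\operatorname{ran}(T-i)^\perp=\ker(T^*+i)$. Let $V$ be the Cayley transform of $T$, i.e. $V(T+i)x=(T-i)x$ for $x\in\operatorname{dom}T$ and $V=0$ on $\operatorname{ran}(T+i)^\perp$. For $\theta\in[0,1)$ put $$U_\theta=V+\frac{e^{2\pi i\theta}}{\|\varphi_+\|^2}\langle\varphi_+,\cdot\rangle\varphi_- ,\qquad T_\theta=b^{-1}(U_\theta),\qquad b(z)=\frac{z-i}{z+i},$$ that is, $T_\theta$ has graph $\{((1-U_\theta)y,\ i(1+U_\theta)y): y\in H\}$. It is a densely defined self-adjoint operator if $1$ is not an eigenvalue of $U_\theta$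 (for all $\theta$ if $T$ is densely defined, for all but one $\theta$ otherwise), and a self-adjoint linear relation in general. A spectral function of $T$ (for $\varphi_\pm$) is a strictly increasing bijection $t:J\to\mathbb R$ from an interval $J\subseteq\mathbb R$ onto $\mathbb R$ such that $\sigma(T_\theta)=\{t(n+\theta): n\in\mathbb Z,\ n+\theta\in J\}$ for every $\theta\in[0,1)$. Write $\tau=t^{-1}:\mathbb R\to J$, and $t_k=t(k)$ for $k\in\mathbb Z\cap J$; also $[s]=s-\lfloor s\rfloor$. Then a spectral function exists. For every spectral function $t$, $t$ is differentiable at every $k\in\mathbb Z\cap J$, and one can choose, for each $\theta\in[0,1)$, an orthonormal basis $\{\varphi_n(\theta): n\in\mathbb Z,\ n+\theta\in J\}$ of $\overline{\operatorname{dom}T_\theta}$ (which is $H$ whenever $T_\theta$ is an operator) with $T_\theta\varphi_n(\theta)=t(n+\theta)\varphi_n(\theta)$, such that, with $\varphi_x:=\varphi_{\lfloor\tau(x)\rfloor}([\tau(x)])$, the function $$K^T(x,y):=\langle\varphi_x,\varphi_y\rangle,\qquad x,y\in\mathbb R,$$ is an infinitely differentiable, real-valued, positive kernel function on $\mathbb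 R\times\mathbb R$; and, if $1$ is not an eigenvalue of $U_0$ (i.e. $T_0$ is a densely defined operator), then for all $x,y\in\mathbb R\setminus\{t_k\}$ $$K^T(x,y)=f(x)(-1)^{\lfloor\tau(x)\rfloor}\left(\sum_{k\in\mathbb Z\cap J}\frac{t'(k)}{(x-t_k)(y-t_k)}\right)(-1)^{\lfloor\tau(y)\rfloor}f(y),\qquad f(x)=\left(\sum_{k\in\mathbb Z\cap J}\frac{t'(k)}{(x-t_k)^2}\right)^{-1/2},$$ where all the series converge. (At the points $t_k$ the right-hand side is understood as its continuous extension.) -/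

import Mathlib

open scoped ContDiff InnerProductSpace ComplexOrder

noncomputable section

namespace SymmetricExtension

variable {H : Type*} [NormedAddCommGroup H] [InnerProductSpace ℂ H]

/-- The linear map `x ↦ T x - z x` on the domain of `T`. -/
def subScalar (T : H →ₗ.[ℂ] H) (z : ℂ) : T.domain →ₗ[ℂ] H :=
  T.toFun - z • T.domain.subtype

/-- `ker (T* - z) = ran (T - conj z)^⊥`. For a `T` that is not densely defined the adjoint is a
linear relation, and the right-hand side still is the kernel of `T* - z`. -/
def defectSpace (T : H →ₗ.[ℂ] H) (z : ℂ) : Submodule ℂ H :=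
  (LinearMap.range (subScalar T (starRingEnd ℂ z)))ᗮ

/-- `T` is simple: there is no non-trivial proper closed subspace `S` such that the restriction
of `T` to `dom T ∩ S` is a self-adjoint operator in `S`. -/
def IsSimple (T : H →ₗ.[ℂ] H) : Prop :=
  ∀ (S : Submodule ℂ H) [CompleteSpace S], S ≠ ⊥ → S ≠ ⊤ →
    ¬ ∃ A : S →ₗ.[ℂ] S, IsSelfAdjoint A ∧
      A.graph.map (S.subtype.prodMap S.subtype) = T.graph ⊓ S.prod ⊤

/-- `T` is regular: `T - t` is bounded below on `dom T` for every real `t`. -/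
def IsRegular (T : H →ₗ.[ℂ] H) : Prop :=
  ∀ t : ℝ, ∃ c : ℝ, 0 < c ∧ ∀ x : T.domain, c * ‖(x : H)‖ ≤ ‖subScalar T (t : ℂ) x‖

/-- The class of closed regular simple symmetric linear transformations with deficiency
indices `(1, 1)` (not necessarily densely defined). -/
structure IsSR (T : H →ₗ.[ℂ] H) : Prop where
  symmetric : T.IsFormalAdjoint T
  closed : T.IsClosed
  simple : IsSimple T
  regular : IsRegular T
  index_plus : Module.finrank ℂ (defectSpace T Complex.I) = 1
  index_minus : Module.finrank ℂ (defectSpace T (-Complex.I)) = 1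

theorem norm_sq_subScalar {T : H →ₗ.[ℂ] H} (hT : T.IsFormalAdjoint T) {z : ℂ}
    (hz : z = Complex.I ∨ z = -Complex.I) (x : T.domain) :
    ‖subScalar T z x‖ ^ 2 = ‖T x‖ ^ 2 + ‖(x : H)‖ ^ 2 := by
  have hzn : ‖z‖ = 1 := by rcases hz with rfl | rfl <;> simp
  have h1 : (inner ℂ (T x) (x : H)).im = 0 := by
    have h2 : inner ℂ (T x) (x : H) = inner ℂ (x : H) (T x) := hT x x
    have h3 := inner_conj_symm (𝕜 := ℂ) (x : H) (T x)
    rw [h2] at h3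
    have h4 := congrArg Complex.im h3
    rw [Complex.conj_im] at h4
    rw [h2]
    linarith
  have h5 : subScalar T z x = T x - z • (x : H) := rfl
  rw [h5, @norm_sub_sq ℂ, norm_smul, hzn, inner_smul_right]
  have h6 : RCLike.re (z * inner ℂ (T x) (x : H)) = 0 := by
    rcases hz with rfl | rfl <;> simp [h1]
  rw [h6]
  ring

/-- The bijection `x ↦ (T + i) x` of `dom T` onto `ran (T + i)`. -/
def rangeEquiv {T : H →ₗ.[ℂ] H} (hT : IsSR T) :
    T.domain ≃ₗ[ℂ] LinearMap.range (subScalar T (-Complex.I)) :=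
  LinearEquiv.ofInjective (subScalar T (-Complex.I)) <| by
    rw [← LinearMap.ker_eq_bot, LinearMap.ker_eq_bot']
    intro x hx
    have h := norm_sq_subScalar hT.symmetric (Or.inr rfl) x
    rw [hx, norm_zero] at h
    have h2 : ‖(x : H)‖ = 0 := by nlinarith [sq_nonneg ‖T x‖, sq_nonneg ‖(x : H)‖]
    exact Subtype.ext (norm_eq_zero.mp h2)

theorem norm_rangeEquiv_symm {T : H →ₗ.[ℂ] H} (hT : IsSR T)
    (y : LinearMap.range (subScalar T (-Complex.I))) :
    ‖subScalar T Complex.I ((rangeEquiv hT).symm y)‖ = ‖y‖ := by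
  obtain ⟨x, rfl⟩ := (rangeEquiv hT).surjective y
  rw [LinearEquiv.symm_apply_apply]
  have h1 := norm_sq_subScalar hT.symmetric (Or.inl rfl) x
  have h2 := norm_sq_subScalar hT.symmetric (Or.inr rfl) x
  have h3 : ‖rangeEquiv hT x‖ = ‖subScalar T (-Complex.I) x‖ := rfl
  rw [h3]
  exact (sq_eq_sq₀ (norm_nonneg _) (norm_nonneg _)).mp (h1.trans h2.symm)

/-- The isometry `(T + i) x ↦ (T - i) x` from `ran (T + i)` into `H`. -/
def cayleyIsometry {T : H →ₗ.[ℂ] H} (hT : IsSR T) :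
    LinearMap.range (subScalar T (-Complex.I)) →ₗᵢ[ℂ] H where
  toLinearMap := subScalar T Complex.I ∘ₗ (rangeEquiv hT).symm.toLinearMap
  norm_map' := norm_rangeEquiv_symm hT

variable [CompleteSpace H]

theorem completeSpace_range {T : H →ₗ.[ℂ] H} (hT : IsSR T) :
    CompleteSpace (LinearMap.range (subScalar T (-Complex.I))) := by
  have hG : CompleteSpace T.graph := hT.closed.completeSpace_coe
  let g : T.graph →L[ℂ] H :=
    ((ContinuousLinearMap.snd ℂ H H) + Complex.I • (ContinuousLinearMap.fst ℂ H H)).comp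
      T.graph.subtypeL
  have hg : ∀ x : T.domain, ∀ h : ((x : H), T x) ∈ T.graph,
      g ⟨((x : H), T x), h⟩ = subScalar T (-Complex.I) x := by
    intro x h
    simp [g, subScalar]
  have hanti : AntilipschitzWith 1 g := by
    apply ContinuousLinearMap.antilipschitz_of_bound
    rintro ⟨⟨a, b⟩, hp⟩
    obtain ⟨x, rfl, rfl⟩ := (LinearPMap.mem_graph_iff T).mp hp
    rw [hg]
    have h2 := norm_sq_subScalar hT.symmetric (Or.inr rfl) x
    have h3 : ‖(⟨((x : H), T x), hp⟩ : T.graph)‖ = max ‖(x : H)‖ ‖T x‖ := rfl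
    rw [h3]
    simp only [NNReal.coe_one, one_mul]
    apply max_le
    · exact le_of_sq_le_sq (by nlinarith [sq_nonneg ‖T x‖]) (norm_nonneg _)
    · exact le_of_sq_le_sq (by nlinarith [sq_nonneg ‖(x : H)‖]) (norm_nonneg _)
  have hr : (LinearMap.range (subScalar T (-Complex.I)) : Set H) = Set.range g := by
    ext y
    constructor
    · rintro ⟨x, rfl⟩
      exact ⟨⟨((x : H), T x), T.mem_graph x⟩, hg x _⟩
    · rintro ⟨⟨⟨a, b⟩, hp⟩, rfl⟩
      obtain ⟨x, rfl, rfl⟩ := (LinearPMap.mem_graph_iff T).mp hp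
      exact ⟨x, (hg x _).symm⟩
  have hc : IsClosed (LinearMap.range (subScalar T (-Complex.I)) : Set H) := by
    rw [hr]
    exact hanti.isClosed_range g.uniformContinuous
  exact hc.completeSpace_coe

/-- The Cayley transform `V = b(T)`, `b(z) = (z - i) / (z + i)`, as a partial isometry on `H`:
`V ((T + i) x) = (T - i) x` for `x ∈ dom T`, and `V = 0` on `ran (T + i)^⊥`. -/
def cayley {T : H →ₗ.[ℂ] H} (hT : IsSR T) : H →L[ℂ] H :=
  haveI := completeSpace_range hT
  (cayleyIsometry hT).toContinuousLinearMap.comp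
    (LinearMap.range (subScalar T (-Complex.I))).orthogonalProjectionOnto

/-- The unitary extensions
`U_θ = V + e^{2πiθ} ‖φ₊‖⁻² ⟨φ₊, ·⟩ φ₋` of `V`. -/
def unitaryExtension {T : H →ₗ.[ℂ] H} (hT : IsSR T) (φp φm : H) (θ : ℝ) : H →L[ℂ] H :=
  cayley hT + (Complex.exp (2 * Real.pi * Complex.I * θ) / (‖φp‖ : ℂ) ^ 2) •
    (innerSL ℂ φp).smulRight φm

/-- The graph of the inverse Cayley transform `b⁻¹(U)`, `b⁻¹(w) = i (1 + w) / (1 - w)`: the set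
of all pairs `((1 - U) y, i (1 + U) y)`. For a unitary `U` it is the graph of a densely defined
self-adjoint operator if `1` is not an eigenvalue of `U`, and a self-adjoint linear relation in
general. -/
def inverseCayley (U : H →L[ℂ] H) : Submodule ℂ (H × H) :=
  LinearMap.range ((1 - U).prod (Complex.I • (1 + U))).toLinearMap

/-- (The graph of) the self-adjoint extension `T_θ = b⁻¹(U_θ)` of `T`. -/
def saExtension {T : H →ₗ.[ℂ] H} (hT : IsSR T) (φp φm : H) (θ : ℝ) : Submodule ℂ (H × H) :=
  inverseCayley (unitaryExtension hT φp φm θ)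

/-- The spectrum of a closed operator (or linear relation) with graph `G`: the set of all `z` for
which `(x, y) ↦ y - z x` is not a bijection from `G` onto `H`. By the open mapping theorem
the inverse of such a bijection is bounded. -/
def graphSpectrum (G : Submodule ℂ (H × H)) : Set ℂ :=
  {z | ¬ Function.Bijective (fun p : G => (p : H × H).2 - z • (p : H × H).1)}

/-- `t` is a strictly increasing bijection from the interval `J` onto `ℝ` that lists the spectra
of the extensions: `σ(T_θ) = { t(n + θ) : n ∈ ℤ, n + θ ∈ J }` for every `θ ∈ [0, 1)`. -/
structure IsSpectralFunction {T : H →ₗ.[ℂ] H} (hT : IsSR T) (φp φm : H)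
    (J : Set ℝ) (t : ℝ → ℝ) : Prop where
  ordConnected : J.OrdConnected
  strictMonoOn : StrictMonoOn t J
  bijOn : Set.BijOn t J Set.univ
  spectrum : ∀ θ ∈ Set.Ico (0 : ℝ) 1, graphSpectrum (saExtension hT φp φm θ) =
    {z | ∃ n : ℤ, (n : ℝ) + θ ∈ J ∧ z = (t (n + θ) : ℂ)}

/-- The phase function `τ : ℝ → J`, the compositional inverse of `t : J → ℝ`. -/
def phase (J : Set ℝ) (t : ℝ → ℝ) : ℝ → ℝ := Function.invFunOn t J

/-- `(e n)`, `n + θ ∈ J`, is an orthonormal basis of the closure of `dom T_θ` (which is `H` when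
`T_θ` is an operator) with `T_θ (e n) = t(n + θ) (e n)`. -/
structure IsOrthonormalEigenbasis {T : H →ₗ.[ℂ] H} (hT : IsSR T) (φp φm : H)
    (J : Set ℝ) (t : ℝ → ℝ) (θ : ℝ) (e : ℤ → H) : Prop where
  orthonormal : Orthonormal ℂ (fun n : {n : ℤ // (n : ℝ) + θ ∈ J} => e n)
  eigenvector : ∀ n : ℤ, (n : ℝ) + θ ∈ J →
    (e n, (t (n + θ) : ℂ) • e n) ∈ saExtension hT φp φm θ
  complete : (Submodule.span ℂ
      (Set.range (fun n : {n : ℤ // (n : ℝ) + θ ∈ J} => e n))).topologicalClosure =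
    ((saExtension hT φp φm θ).map (LinearMap.fst ℂ H H)).topologicalClosure

/-- `φ_x = φ_{⌊τ(x)⌋}([τ(x)])`, where `[s] = s - ⌊s⌋`. -/
def eigenvectorAt (J : Set ℝ) (t : ℝ → ℝ) (e : ℝ → ℤ → H) (x : ℝ) : H :=
  e (Int.fract (phase J t x)) ⌊phase J t x⌋

/-- `K(x, y) = ⟨φ_x, φ_y⟩`, conjugate linear in the first argument. -/
def kernel (J : Set ℝ) (t : ℝ → ℝ) (e : ℝ → ℤ → H) (x y : ℝ) : ℂ :=
  ⟪eigenvectorAt J t e x, eigenvectorAt J t e y⟫_ℂ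

/-- `K` is a positive kernel function on `ℝ × ℝ`. -/
def IsPositiveKernel (K : ℝ → ℝ → ℂ) : Prop :=
  ∀ (N : ℕ) (x : Fin N → ℝ), (Matrix.of fun k j => K (x k) (x j)).PosSemidef

/-- The index set of the sequence `t_k = t(k)`. -/
abbrev Index (J : Set ℝ) : Type := {k : ℤ // (k : ℝ) ∈ J}

/-- `f(x) = (∑ₖ t'(k) / (x - t_k)²)^{-1/2}`. -/
def weight (J : Set ℝ) (t : ℝ → ℝ) (x : ℝ) : ℝ :=
  (∑' k : Index J, deriv t (k : ℤ) / (x - t (k : ℤ)) ^ 2) ^ (-(1 / 2) : ℝ)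

end SymmetricExtension

end

/-! All extensions are rank one twists of one unitary `U = U_0`: `U_θ` multiplies `U φ₊` by
`e^{2πiθ}` and agrees with `U` on `φ₊^⊥ = ran (T + i)`. Regularity of `T` makes `U - b(x)` bounded
below on `φ₊^⊥` for every real `x`. So no twist has an eigenvector for `b(x)` inside `φ₊^⊥`, and
exactly one unimodular `a(x)` makes `b(x)` an eigenvalue of the twist by `a(x)`; it is simple, with
eigenvector `v_x` normalised by `⟨φ₊, v_x⟩ = 1` (`exists_eigenvector`, `param_eq`, `eq_smul_vec`).

Comparing two twists gives `(conj b(x) b(y) - 1) ⟨v_x, v_y⟩ ‖φ₊‖² = conj a(x) a(y) - 1`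
(`inner_vec_vec`). Near the diagonal this shows that `a` runs round the circle with positive speed,
so `a = e^{2πi·lift}` with `lift` smooth and strictly increasing, and `σ(T_θ)` is the set where
`lift ∈ θ + ℤ`. The inverse of `lift` is thus a spectral function, and every other phase differs
from `lift` by an integer (`exists_lift_eq_phase_add`). Off the diagonal, unit vectors with suitable
phases have inner product `sin(π(lift y - lift x)) / (π (y - x) √(ρ(x) ρ(y)))`, `ρ = lift'`
(`inner_eigenfunction`): real, and zero when the phases differ by a non-zero integer.

On the complement of the eigenvectors for eigenvalues other than `1` a twist has spectrum in `{1}`,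
hence is the identity; this gives completeness. Parseval in the eigenbasis of `T_0`, with `t'(k) = 1
/ ρ(t_k)`, gives the series, and its diagonal case identifies `f`. -/

noncomputable section

namespace SymmetricExtension

/-! ### The Cayley parametrisation of the unit circle -/

section UnitCircle

/-- The real Cayley point `b(x) = (x - i) / (x + i)` on the unit circle. -/
def circlePoint (x : ℝ) : ℂ := ((x : ℂ) - Complex.I) / ((x : ℂ) + Complex.I)

theorem add_I_ne_zero (x : ℝ) : (x : ℂ) + Complex.I ≠ 0 := by
  intro h
  simpa using congrArg Complex.im h

theorem sub_I_ne_zero (x : ℝ) : (x : ℂ) - Complex.I ≠ 0 := by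
  intro h
  simpa using congrArg Complex.im h

theorem circlePoint_ne_zero (x : ℝ) : circlePoint x ≠ 0 :=
  div_ne_zero (sub_I_ne_zero x) (add_I_ne_zero x)

theorem conj_circlePoint (x : ℝ) :
    starRingEnd ℂ (circlePoint x) = ((x : ℂ) + Complex.I) / ((x : ℂ) - Complex.I) := by
  simp [circlePoint, sub_eq_add_neg]

theorem conj_mul_circlePoint (x : ℝ) : starRingEnd ℂ (circlePoint x) * circlePoint x = 1 := by
  rw [conj_circlePoint, circlePoint]
  have h1 := add_I_ne_zero x
  have h2 := sub_I_ne_zero x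
  field_simp

theorem norm_circlePoint (x : ℝ) : ‖circlePoint x‖ = 1 := by
  have h := conj_mul_circlePoint x
  rw [Complex.conj_mul'] at h
  have h' : ‖circlePoint x‖ ^ 2 = 1 := by exact_mod_cast h
  exact (pow_eq_one_iff_of_nonneg (norm_nonneg _) two_ne_zero).mp h'

/-- Source of the denominator `y - x` in the kernel. -/
theorem conj_circlePoint_mul_sub_one (x y : ℝ) :
    starRingEnd ℂ (circlePoint x) * circlePoint y - 1 =
      2 * Complex.I * ((y : ℂ) - x) / (((x : ℂ) - Complex.I) * ((y : ℂ) + Complex.I)) := by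
  rw [conj_circlePoint, circlePoint]
  have h1 := add_I_ne_zero y
  have h2 := sub_I_ne_zero x
  field_simp
  linear_combination (0 : ℂ) * Complex.I_sq

theorem circlePoint_ne_one (x : ℝ) : circlePoint x ≠ 1 := by
  rw [circlePoint, Ne, div_eq_one_iff_eq (add_I_ne_zero x)]
  intro h
  have := congrArg Complex.im h
  norm_num at this

theorem exists_circlePoint {z : ℂ} (hz : ‖z‖ = 1) (hz1 : z ≠ 1) : ∃ x : ℝ, circlePoint x = z := by
  have h1 : 1 - z ≠ 0 := sub_ne_zero.mpr hz1.symm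
  have hc : starRingEnd ℂ z * z = 1 := by rw [Complex.conj_mul', hz]; norm_num
  have hc1 : 1 - starRingEnd ℂ z ≠ 0 := by
    intro h
    apply h1
    have := congrArg (starRingEnd ℂ) h
    simpa using this
  -- The inverse Cayley transform of a unimodular number is fixed by conjugation, hence real.
  obtain ⟨x, hx⟩ : ∃ x : ℝ, Complex.I * (1 + z) / (1 - z) = x := by
    rw [← Complex.conj_eq_iff_real]
    simp only [map_div₀, map_mul, map_add, map_sub, map_one, Complex.conj_I]
    rw [div_eq_div_iff hc1 h1]
    linear_combination 2 * Complex.I * hc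
  refine ⟨x, ?_⟩
  rw [circlePoint, div_eq_iff (add_I_ne_zero x), ← hx]
  field_simp
  ring

theorem hasDerivAt_circlePoint (x : ℝ) :
    HasDerivAt circlePoint (2 * Complex.I / ((x : ℂ) + Complex.I) ^ 2) x := by
  have h := add_I_ne_zero x
  have h1 : HasDerivAt (fun z : ℂ => (z - Complex.I) / (z + Complex.I))
      (2 * Complex.I / ((x : ℂ) + Complex.I) ^ 2) (x : ℂ) := by
    have := ((hasDerivAt_id (x : ℂ)).sub_const Complex.I).div
      ((hasDerivAt_id (x : ℂ)).add_const Complex.I) h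
    convert! this using 1
    simp only [id]
    ring
  exact h1.comp_ofReal

theorem contDiff_circlePoint : ContDiff ℝ ∞ circlePoint := by
  unfold circlePoint
  simp only [div_eq_mul_inv]
  exact (Complex.ofRealCLM.contDiff.sub contDiff_const).mul
    ((Complex.ofRealCLM.contDiff.add contDiff_const).inv add_I_ne_zero)

/-! ### Unitary operators with discrete spectrum off `1` -/

section Unitary

variable {X : Type*} [NormedAddCommGroup X] [InnerProductSpace ℂ X] [CompleteSpace X]

theorem mem_unitary_of_norm_map {u : X →L[ℂ] X} (h : ∀ x, ‖u x‖ = ‖x‖)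
    (hs : Function.Surjective u) : u ∈ unitary (X →L[ℂ] X) := by
  have h1 : star u * u = 1 := (u.norm_map_iff_adjoint_comp_self).mp h
  refine Unitary.mem_iff.mpr ⟨h1, ?_⟩
  ext x
  obtain ⟨y, rfl⟩ := hs x
  have h2 := congrArg (fun A : X →L[ℂ] X => u (A y)) h1
  simpa using h2

theorem unitary_apply_star_apply {W : X →L[ℂ] X} (hW : W ∈ unitary (X →L[ℂ] X)) (x : X) :
    W (star W x) = x := by
  have := congrArg (fun A : X →L[ℂ] X => A x) (Unitary.mul_star_self_of_mem hW)
  simpa using this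

/-- If `W - b` is injective, and bounded below on a hyperplane, then it is invertible. -/
theorem isUnit_sub_smul_one {W : X →L[ℂ] X} (hW : W ∈ unitary (X →L[ℂ] X)) (f : X →L[ℂ] ℂ) {b : ℂ}
    (hb : ∃ c : ℝ, 0 < c ∧ ∀ v, f v = 0 → c * ‖v‖ ≤ ‖W v - b • v‖)
    (hinj : ∀ v, W v = b • v → v = 0) : IsUnit (W - b • (1 : X →L[ℂ] X)) := by
  obtain ⟨c, hc, hb⟩ := hb
  set A : X →L[ℂ] X := W - b • (1 : X →L[ℂ] X) with hA
  have hAv : ∀ v, A v = W v - b • v := fun v => rfl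
  have hinjA : Function.Injective A := by
    rw [injective_iff_map_eq_zero]
    intro v hv
    exact hinj v (sub_eq_zero.mp hv)
  have hnormal : IsStarNormal A := by
    have h1 := Unitary.star_mul_self_of_mem hW
    have h2 := Unitary.mul_star_self_of_mem hW
    refine ⟨?_⟩
    rw [Commute, SemiconjBy, hA]
    simp only [star_sub, star_smul, star_one, sub_mul, mul_sub, h1, h2, smul_mul_assoc,
      mul_smul_comm, one_mul, mul_one, smul_sub, smul_smul]
    rw [mul_comm b (star b)]
    abel
  -- `A` maps the closed subspace `ker f` onto a closed set because it is bounded below there, and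
  -- adding finitely many dimensions keeps the range closed.
  have hclosed : IsClosed (A.range : Set X) := by
    have : (LinearMap.ker f.toLinearMap).CoFG := Submodule.CoFG.ker _
    apply LinearMap.isClosed_range_of_isClosed_map_of_finiteDimensional_quotient
      (s := LinearMap.ker f.toLinearMap)
    have hK : CompleteSpace (LinearMap.ker f.toLinearMap) :=
      (ContinuousLinearMap.isClosed_ker f).completeSpace_coe
    have hanti : AntilipschitzWith (Real.toNNReal c⁻¹)
        (A.comp (LinearMap.ker f.toLinearMap).subtypeL) := by
      apply ContinuousLinearMap.antilipschitz_of_bound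
      rintro ⟨v, hv⟩
      have := hb v hv
      rw [Real.coe_toNNReal _ (inv_nonneg.mpr hc.le), inv_mul_eq_div, le_div_iff₀ hc, mul_comm]
      exact this
    have := hanti.isClosed_range (A.comp (LinearMap.ker f.toLinearMap).subtypeL).uniformContinuous
    convert! this using 1
    ext y
    simp
  rw [ContinuousLinearMap.isUnit_iff_bijective]
  refine ⟨hinjA, ?_⟩
  -- For a normal operator the complement of the range is the kernel, so injectivity yields dense
  -- range.
  have h1 : A.rangeᗮ = ⊥ := by
    rw [ContinuousLinearMap.IsStarNormal.orthogonal_range hnormal]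
    exact LinearMap.ker_eq_bot.mpr hinjA
  have hcs : CompleteSpace A.range := hclosed.completeSpace_coe
  exact LinearMap.range_eq_top.mp ((Submodule.orthogonal_eq_bot_iff).mp h1)

/-- A unitary operator whose spectrum off `1` is discrete is the identity if it has no eigenvalue
other than `1`. -/
theorem eq_one_of_forall_not_eigenvector {A : X →L[ℂ] X} (hA : A ∈ unitary (X →L[ℂ] X))
    (f : X →L[ℂ] ℂ)
    (hb : ∀ x : ℝ, ∃ c : ℝ, 0 < c ∧ ∀ v, f v = 0 → c * ‖v‖ ≤ ‖A v - circlePoint x • v‖)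
    (hinj : ∀ (x : ℝ) (v : X), A v = circlePoint x • v → v = 0) : A = 1 := by
  have hspec : spectrum ℂ A ⊆ {1} := by
    intro z hz
    by_contra hz1
    obtain ⟨x, rfl⟩ := exists_circlePoint
      (mem_sphere_zero_iff_norm.mp (spectrum.subset_circle_of_unitary hA hz)) hz1
    refine hz ?_
    have h2 := (isUnit_sub_smul_one hA f (hb x) (hinj x)).neg
    rw [neg_sub] at h2
    rwa [spectrum.mem_resolventSet_iff, Algebra.algebraMap_eq_smul_one]
  have hnorm : IsStarNormal A := by
    refine ⟨?_⟩
    rw [Commute, SemiconjBy, Unitary.star_mul_self_of_mem hA, Unitary.mul_star_self_of_mem hA]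
  exact CFC.eq_one_of_spectrum_subset_one (R := ℂ) A hspec hnorm

/-- The restriction of an operator to an invariant subspace. -/
def restrictOp (W : X →L[ℂ] X) (S : Submodule ℂ X) (hS : ∀ v ∈ S, W v ∈ S) : S →L[ℂ] S :=
  (W.comp S.subtypeL).codRestrict S fun v => hS v v.2

/-- A unitary operator whose spectrum off `1` is discrete acts as the identity on the orthogonal
complement of its eigenvectors for eigenvalues other than `1`. -/
theorem apply_eq_self_of_orthogonal_eigenvectors {W : X →L[ℂ] X}
    (hW : W ∈ unitary (X →L[ℂ] X)) (f : X →L[ℂ] ℂ)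
    (hb : ∀ x : ℝ, ∃ c : ℝ, 0 < c ∧ ∀ v, f v = 0 → c * ‖v‖ ≤ ‖W v - circlePoint x • v‖)
    {v : X} (hv : ∀ (x : ℝ) (k : X), W k = circlePoint x • k → ⟪k, v⟫_ℂ = 0) : W v = v := by
  -- `S` reduces `W`, and an eigenvector of the restriction for an eigenvalue other than `1` would
  -- be orthogonal to itself.
  set S : Submodule ℂ X := (Submodule.span ℂ {k | ∃ x : ℝ, W k = circlePoint x • k})ᗮ with hSdef
  have hmem : ∀ u : X, u ∈ S ↔ ∀ (x : ℝ) (k : X), W k = circlePoint x • k → ⟪k, u⟫_ℂ = 0 := by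
    intro u
    rw [hSdef, Submodule.mem_orthogonal]
    constructor
    · intro h x k hk
      exact h k (Submodule.subset_span ⟨x, hk⟩)
    · intro h k hk
      induction hk using Submodule.span_induction with
      | mem k hk => obtain ⟨x, hx⟩ := hk; exact h x k hx
      | zero => simp
      | add a b _ _ ha hb => rw [inner_add_left, ha, hb, add_zero]
      | smul r a _ ha => rw [inner_smul_left, ha, mul_zero]
  have hWS : ∀ u ∈ S, W u ∈ S := by
    intro u hu
    rw [hmem] at hu ⊢
    intro x k hk
    have h1 : ⟪W k, W u⟫_ℂ = ⟪k, u⟫_ℂ := ContinuousLinearMap.inner_map_map_of_mem_unitary hW k u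
    rw [hk, hu x k hk, inner_smul_left, mul_eq_zero] at h1
    rcases h1 with h1 | h1
    · exact absurd ((map_eq_zero _).mp h1) (circlePoint_ne_zero x)
    · exact h1
  have hWS' : ∀ u ∈ S, star W u ∈ S := by
    intro u hu
    rw [hmem] at hu ⊢
    intro x k hk
    rw [ContinuousLinearMap.star_eq_adjoint, ContinuousLinearMap.adjoint_inner_right, hk,
      inner_smul_left, hu x k hk, mul_zero]
  set A := restrictOp W S hWS with hA
  have hAv : ∀ u : S, ((A u : S) : X) = W u := fun u => rfl
  have hAu : A ∈ unitary (S →L[ℂ] S) := by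
    apply mem_unitary_of_norm_map
    · intro u
      exact ContinuousLinearMap.norm_map_of_mem_unitary hW u
    · intro u
      exact ⟨⟨star W u, hWS' u u.2⟩, Subtype.ext (unitary_apply_star_apply hW u)⟩
  have h1 : A = 1 := by
    refine eq_one_of_forall_not_eigenvector hAu (f.comp S.subtypeL) (fun x => ?_) ?_
    · obtain ⟨c, hc, h⟩ := hb x
      exact ⟨c, hc, fun u hu => h u hu⟩
    · intro x u hu
      have h1 : W u = circlePoint x • (u : X) := congrArg Subtype.val hu
      have h2 := (hmem u).mp u.2 x u h1
      exact Subtype.ext (inner_self_eq_zero.mp h2)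
  have h2 := congrArg (fun B : S →L[ℂ] S => ((B ⟨v, (hmem v).mpr hv⟩ : S) : X)) h1
  exact h2

end Unitary

end UnitCircle

/-! ### Rank one twists and their eigenvectors -/

section RankOneTwist

variable {H : Type*} [NormedAddCommGroup H] [InnerProductSpace ℂ H]

/-- The rank one perturbation of `U` that multiplies the image of `p` by `a` and agrees with `U`
on `p^⊥`. -/
def twist (U : H →L[ℂ] H) (p : H) (a : ℂ) : H →L[ℂ] H :=
  U + ((a - 1) / (‖p‖ : ℂ) ^ 2) • (innerSL ℂ p).smulRight (U p)

theorem twist_apply (U : H →L[ℂ] H) (p : H) (a : ℂ) (v : H) :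
    twist U p a v = U v + ((a - 1) / (‖p‖ : ℂ) ^ 2 * ⟪p, v⟫_ℂ) • U p := by
  simp [twist, smul_smul]

theorem twist_apply_of_inner_eq_zero (U : H →L[ℂ] H) {p : H} (a : ℂ) {v : H}
    (hv : ⟪p, v⟫_ℂ = 0) : twist U p a v = U v := by
  rw [twist_apply, hv, mul_zero, zero_smul, add_zero]

variable [CompleteSpace H]

/-- A unitary operator `U` and a vector `p ≠ 0` such that `U - b` is bounded below on `p^⊥` for
each `b ≠ 1` on the unit circle. -/
structure IsRegularPair (U : H →L[ℂ] H) (p : H) : Prop where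
  mem_unitary : U ∈ unitary (H →L[ℂ] H)
  ne_zero : p ≠ 0
  bound : ∀ x : ℝ, ∃ c : ℝ, 0 < c ∧ ∀ v, ⟪p, v⟫_ℂ = 0 → c * ‖v‖ ≤ ‖U v - circlePoint x • v‖

namespace IsRegularPair

variable {U : H →L[ℂ] H} {p : H} (h : IsRegularPair U p)

include h

theorem norm_ne_zero : (‖p‖ : ℂ) ≠ 0 := by
  exact_mod_cast norm_ne_zero_iff.mpr h.ne_zero

theorem inner_twist (a a' : ℂ) (v v' : H) :
    ⟪twist U p a v, twist U p a' v'⟫_ℂ =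
      ⟪v, v'⟫_ℂ + (starRingEnd ℂ a * a' - 1) / (‖p‖ : ℂ) ^ 2 * (⟪v, p⟫_ℂ * ⟪p, v'⟫_ℂ) := by
  have hU : ∀ u u', ⟪U u, U u'⟫_ℂ = ⟪u, u'⟫_ℂ :=
    ContinuousLinearMap.inner_map_map_of_mem_unitary h.mem_unitary
  have hn := h.norm_ne_zero
  simp only [twist_apply, inner_add_left, inner_add_right, inner_smul_left, inner_smul_right, hU,
    map_mul, map_div₀, map_sub, map_one, map_pow, Complex.conj_ofReal, inner_conj_symm]
  rw [inner_self_eq_norm_sq_to_K]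
  simp only [Complex.coe_algebraMap]
  field_simp
  ring

theorem twist_mem_unitary {a : ℂ} (ha : ‖a‖ = 1) : twist U p a ∈ unitary (H →L[ℂ] H) := by
  have hn := h.norm_ne_zero
  have ha' : a * starRingEnd ℂ a = 1 := by rw [Complex.mul_conj', ha]; norm_num
  apply mem_unitary_of_norm_map
  · intro v
    have h1 := h.inner_twist a a v v
    rw [mul_comm (starRingEnd ℂ a) a, ha', sub_self, zero_div, zero_mul, add_zero,
      inner_self_eq_norm_sq_to_K, inner_self_eq_norm_sq_to_K] at h1
    have h2 : ‖twist U p a v‖ ^ 2 = ‖v‖ ^ 2 := by exact_mod_cast h1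
    exact (sq_eq_sq₀ (norm_nonneg _) (norm_nonneg _)).mp h2
  · intro w
    set u := star U w
    have hu : U u = w := unitary_apply_star_apply h.mem_unitary w
    -- The component of `u` along `p` is multiplied by `conj a = a⁻¹`, which undoes the twist.
    refine ⟨u + ((starRingEnd ℂ a - 1) / (‖p‖ : ℂ) ^ 2 * ⟪p, u⟫_ℂ) • p, ?_⟩
    rw [twist_apply, map_add, map_smul, hu, inner_add_right, inner_smul_right,
      inner_self_eq_norm_sq_to_K, add_assoc, ← add_smul]
    convert add_zero w
    rw [smul_eq_zero]
    left
    simp only [Complex.coe_algebraMap]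
    field_simp
    linear_combination ⟪p, u⟫_ℂ * ha'

theorem twist_bound (a : ℂ) (x : ℝ) : ∃ c : ℝ, 0 < c ∧ ∀ v, innerSL ℂ p v = 0 →
    c * ‖v‖ ≤ ‖twist U p a v - circlePoint x • v‖ := by
  obtain ⟨c, hc, hb⟩ := h.bound x
  refine ⟨c, hc, fun v hv => ?_⟩
  rw [twist_apply_of_inner_eq_zero U a hv]
  exact hb v hv

theorem isUnit_twist_sub {a : ℂ} (ha : ‖a‖ = 1) {x : ℝ}
    (hinj : ∀ v, twist U p a v = circlePoint x • v → v = 0) :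
    IsUnit (twist U p a - circlePoint x • (1 : H →L[ℂ] H)) :=
  isUnit_sub_smul_one (h.twist_mem_unitary ha) (innerSL ℂ p) (h.twist_bound a x) hinj

/-- On `p^⊥` every twist equals `U`, and there the lower bound rules out eigenvectors. -/
theorem eq_zero_of_inner_eq_zero {a : ℂ} {x : ℝ} {v : H}
    (hv : twist U p a v = circlePoint x • v) (hp : ⟪p, v⟫_ℂ = 0) : v = 0 := by
  obtain ⟨c, hc, hb⟩ := h.twist_bound a x
  have h1 := hb v hp
  rw [hv, sub_self, norm_zero] at h1
  exact norm_eq_zero.mp (le_antisymm (by nlinarith [norm_nonneg v]) (norm_nonneg v))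

/-- The eigenvalue equations inserted into `inner_twist`. Uniqueness of the parameter, orthogonality
and the kernel all come from this identity. -/
theorem inner_eigenvectors {a a' : ℂ} {x x' : ℝ} {v v' : H}
    (hv : twist U p a v = circlePoint x • v) (hv' : twist U p a' v' = circlePoint x' • v') :
    (starRingEnd ℂ (circlePoint x) * circlePoint x' - 1) * ⟪v, v'⟫_ℂ * (‖p‖ : ℂ) ^ 2 =
      (starRingEnd ℂ a * a' - 1) * (⟪v, p⟫_ℂ * ⟪p, v'⟫_ℂ) := by
  have h1 := h.inner_twist a a' v v'
  have hn := h.norm_ne_zero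
  rw [hv, hv', inner_smul_left, inner_smul_right] at h1
  field_simp at h1
  linear_combination h1

theorem twist_parameter_unique {a a' : ℂ} (ha : ‖a‖ = 1) {x : ℝ} {v v' : H}
    (hv : twist U p a v = circlePoint x • v) (hv' : twist U p a' v' = circlePoint x • v')
    (h0 : v ≠ 0) (h0' : v' ≠ 0) : a' = a := by
  have h1 := h.inner_eigenvectors hv hv'
  rw [conj_mul_circlePoint, sub_self, zero_mul, zero_mul, eq_comm, mul_eq_zero, mul_eq_zero] at h1
  have ha' : a * starRingEnd ℂ a = 1 := by rw [Complex.mul_conj', ha]; norm_num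
  rcases h1 with h1 | h1 | h1
  · linear_combination a * h1 - a' * ha'
  · exact absurd (h.eq_zero_of_inner_eq_zero hv (inner_eq_zero_symm.mp h1)) h0
  · exact absurd (h.eq_zero_of_inner_eq_zero hv' h1) h0'

theorem eigenvector_unique {a : ℂ} {x : ℝ} {v v' : H}
    (hv : twist U p a v = circlePoint x • v) (hv' : twist U p a v' = circlePoint x • v')
    (hp : ⟪p, v⟫_ℂ = ⟪p, v'⟫_ℂ) : v = v' := by
  refine sub_eq_zero.mp (h.eq_zero_of_inner_eq_zero (a := a) (x := x) ?_ ?_)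
  · rw [map_sub, hv, hv', smul_sub]
  · rw [inner_sub_right, hp, sub_self]

/-- Lowering the parameter by `‖p‖² / ⟨p, r⟩` subtracts exactly `U p` from the image of `r`, which
turns a resolvent vector into an eigenvector. -/
theorem eigenvector_of_resolvent {a₁ : ℂ} {x : ℝ} {r : H}
    (hr : twist U p a₁ r - circlePoint x • r = U p) :
    ⟪p, r⟫_ℂ ≠ 0 ∧ ∃ a : ℂ, ‖a‖ = 1 ∧ twist U p a r = circlePoint x • r := by
  have hn := h.norm_ne_zero
  -- If `r ⊥ p`, then `U (r - p) = b(x) r`, so `‖r - p‖ = ‖r‖`; Pythagoras then forces `p = 0`.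
  have hq : ⟪p, r⟫_ℂ ≠ 0 := by
    intro hq
    rw [twist_apply_of_inner_eq_zero U a₁ hq, sub_eq_iff_eq_add, ← sub_eq_iff_eq_add',
      ← map_sub] at hr
    have h1 := ContinuousLinearMap.norm_map_of_mem_unitary h.mem_unitary (r - p)
    rw [hr, norm_smul, norm_circlePoint, one_mul] at h1
    have h2 := @norm_sub_sq ℂ _ _ _ _ r p
    rw [inner_eq_zero_symm.mp hq, ← h1] at h2
    have h3 : ‖p‖ ^ 2 = 0 := by simpa using h2
    exact h.ne_zero (by simpa using h3)
  have hq' : ⟪r, p⟫_ℂ ≠ 0 := fun h0 => hq (inner_eq_zero_symm.mp h0)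
  set a := a₁ - (‖p‖ : ℂ) ^ 2 / ⟪p, r⟫_ℂ with ha
  have hev : twist U p a r = circlePoint x • r := by
    have h1 : twist U p a r = twist U p a₁ r - U p := by
      have h2 : (a - 1) / (‖p‖ : ℂ) ^ 2 * ⟪p, r⟫_ℂ =
          (a₁ - 1) / (‖p‖ : ℂ) ^ 2 * ⟪p, r⟫_ℂ - 1 := by
        rw [ha]
        field_simp
        ring
      rw [twist_apply, twist_apply, h2, sub_smul, one_smul, add_sub_assoc]
    rw [h1, ← hr, sub_sub_cancel]
  refine ⟨hq, a, ?_, hev⟩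
  -- Pairing the eigenvector with itself makes the left side vanish and leaves `|a|² = 1`.
  have h1 := h.inner_eigenvectors hev hev
  rw [conj_mul_circlePoint, sub_self, zero_mul, zero_mul, eq_comm, mul_eq_zero, mul_eq_zero,
    Complex.conj_mul'] at h1
  have h2 : (‖a‖ : ℂ) ^ 2 = 1 := sub_eq_zero.mp (by simpa [hq, hq'] using h1)
  have h3 : ‖a‖ ^ 2 = 1 := by exact_mod_cast h2
  exact (pow_eq_one_iff_of_nonneg (norm_nonneg _) two_ne_zero).mp h3

theorem exists_normalized {a : ℂ} (ha : ‖a‖ = 1) {x : ℝ} {v : H} (h0 : v ≠ 0)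
    (hv : twist U p a v = circlePoint x • v) :
    ∃ a : ℂ, ‖a‖ = 1 ∧ ∃ k : H, twist U p a k = circlePoint x • k ∧ ⟪p, k⟫_ℂ = 1 := by
  have hq : ⟪p, v⟫_ℂ ≠ 0 := fun hq => h0 (h.eq_zero_of_inner_eq_zero hv hq)
  refine ⟨a, ha, (⟪p, v⟫_ℂ)⁻¹ • v, ?_, ?_⟩
  · rw [map_smul, hv, smul_comm]
  · rw [inner_smul_right, inv_mul_cancel₀ hq]

/-- Either `b(x)` is already an eigenvalue of the twist by `1`, or `U - b(x)` is invertible and the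
resolvent vector of `U p` is an eigenvector of another twist. -/
theorem exists_eigenvector (x : ℝ) :
    ∃ a : ℂ, ‖a‖ = 1 ∧ ∃ k : H, twist U p a k = circlePoint x • k ∧ ⟪p, k⟫_ℂ = 1 := by
  by_cases hinj : ∀ v, twist U p 1 v = circlePoint x • v → v = 0
  · obtain ⟨r, hr⟩ := (ContinuousLinearMap.isUnit_iff_bijective.mp
      (h.isUnit_twist_sub norm_one hinj)).surjective (U p)
    obtain ⟨hq, a, ha, hev⟩ := h.eigenvector_of_resolvent (x := x) (r := r) hr
    exact h.exists_normalized ha (fun h0 => hq (by rw [h0, inner_zero_right])) hev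
  · push Not at hinj
    obtain ⟨v, hv, h0⟩ := hinj
    exact h.exists_normalized norm_one h0 hv

/-- The parameter `a` for which `b(x)` is an eigenvalue of `twist U p a`. -/
def param (x : ℝ) : ℂ := (h.exists_eigenvector x).choose

/-- The eigenvector for the eigenvalue `b(x)` whose inner product with `p` is `1`. -/
def vec (x : ℝ) : H := (h.exists_eigenvector x).choose_spec.2.choose

theorem norm_param (x : ℝ) : ‖h.param x‖ = 1 := (h.exists_eigenvector x).choose_spec.1

theorem param_ne_zero (x : ℝ) : h.param x ≠ 0 := by
  rw [← norm_ne_zero_iff, h.norm_param]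
  exact one_ne_zero

theorem twist_vec (x : ℝ) : twist U p (h.param x) (h.vec x) = circlePoint x • h.vec x :=
  (h.exists_eigenvector x).choose_spec.2.choose_spec.1

theorem inner_vec (x : ℝ) : ⟪p, h.vec x⟫_ℂ = 1 :=
  (h.exists_eigenvector x).choose_spec.2.choose_spec.2

theorem vec_ne_zero (x : ℝ) : h.vec x ≠ 0 := by
  intro h0
  have := h.inner_vec x
  rw [h0, inner_zero_right] at this
  exact zero_ne_one this

theorem param_eq {a : ℂ} {x : ℝ} {v : H} (hv : twist U p a v = circlePoint x • v) (h0 : v ≠ 0) :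
    a = h.param x :=
  h.twist_parameter_unique (h.norm_param x) (h.twist_vec x) hv (h.vec_ne_zero x) h0

theorem eq_smul_vec {a : ℂ} {x : ℝ} {v : H} (hv : twist U p a v = circlePoint x • v) :
    v = ⟪p, v⟫_ℂ • h.vec x := by
  by_cases h0 : v = 0
  · simp [h0]
  have ha := h.param_eq hv h0
  subst ha
  refine h.eigenvector_unique hv (v' := ⟪p, v⟫_ℂ • h.vec x) ?_ ?_
  · rw [map_smul, h.twist_vec, smul_comm]
  · rw [inner_smul_right, h.inner_vec, mul_one]

theorem inner_vec_vec (x y : ℝ) :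
    (starRingEnd ℂ (circlePoint x) * circlePoint y - 1) * ⟪h.vec x, h.vec y⟫_ℂ * (‖p‖ : ℂ) ^ 2 =
      starRingEnd ℂ (h.param x) * h.param y - 1 := by
  rw [h.inner_eigenvectors (h.twist_vec x) (h.twist_vec y), h.inner_vec, ← inner_conj_symm,
    h.inner_vec]
  simp

/-- Near each point `vec` is a normalised resolvent vector of one fixed twist, and inversion of
operators is smooth. -/
theorem contDiff_vec : ContDiff ℝ ∞ h.vec := by
  rw [contDiff_iff_contDiffAt]
  intro x₀
  -- Any unimodular value other than `param x₀` would do: `b(x₀)` is then no eigenvalue of the twist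
  -- by `a₁`.
  set a₁ := -h.param x₀ with ha₁
  have hn₁ : ‖a₁‖ = 1 := by rw [ha₁, norm_neg, h.norm_param]
  have hunit : IsUnit (twist U p a₁ - circlePoint x₀ • (1 : H →L[ℂ] H)) := by
    refine h.isUnit_twist_sub hn₁ fun v hv => ?_
    by_contra h0
    have h1 := h.param_eq hv h0
    rw [ha₁, neg_eq_iff_add_eq_zero, ← two_mul] at h1
    exact h.param_ne_zero x₀ (by simpa using h1)
  have hA : ContDiff ℝ ∞ fun x : ℝ => twist U p a₁ - circlePoint x • (1 : H →L[ℂ] H) :=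
    contDiff_const.sub (contDiff_circlePoint.smul contDiff_const)
  obtain ⟨u, hu⟩ := hunit
  have hR : ContDiffAt ℝ ∞
      (fun x : ℝ => Ring.inverse (twist U p a₁ - circlePoint x • (1 : H →L[ℂ] H))) x₀ := by
    have h1 := contDiffAt_ringInverse ℝ (n := ∞) u
    rw [hu] at h1
    exact h1.comp x₀ hA.contDiffAt
  set r : ℝ → H := fun x =>
    Ring.inverse (twist U p a₁ - circlePoint x • (1 : H →L[ℂ] H)) (U p) with hr
  have hrd : ContDiffAt ℝ ∞ r x₀ := by
    have hev : ContDiff ℝ ∞ fun A : H →L[ℂ] H => A (U p) :=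
      (((ContinuousLinearMap.apply ℂ H (U p)).restrictScalars ℝ)).contDiff
    exact hev.contDiffAt.comp x₀ hR
  have hopen : ∀ᶠ x in nhds x₀, IsUnit (twist U p a₁ - circlePoint x • (1 : H →L[ℂ] H)) := by
    have h1 : {A : H →L[ℂ] H | IsUnit A} ∈
        nhds (twist U p a₁ - circlePoint x₀ • (1 : H →L[ℂ] H)) :=
      Units.isOpen.mem_nhds ⟨u, hu⟩
    exact hA.continuous.continuousAt.eventually h1
  have hres : ∀ x, IsUnit (twist U p a₁ - circlePoint x • (1 : H →L[ℂ] H)) →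
      twist U p a₁ (r x) - circlePoint x • r x = U p := by
    intro x hx
    have h1 := Ring.mul_inverse_cancel _ hx
    exact congrArg (fun A : H →L[ℂ] H => A (U p)) h1
  have heq : h.vec =ᶠ[nhds x₀] fun x => (⟪p, r x⟫_ℂ)⁻¹ • r x := by
    filter_upwards [hopen] with x hx
    obtain ⟨hq, a, ha, hev⟩ := h.eigenvector_of_resolvent (hres x hx)
    rw [eq_inv_smul_iff₀ hq]
    exact (h.eq_smul_vec hev).symm
  refine ContDiffAt.congr_of_eventuallyEq ?_ heq
  have hin : ContDiffAt ℝ ∞ (fun x => ⟪p, r x⟫_ℂ) x₀ := contDiffAt_const.inner ℂ hrd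
  exact (hin.inv (h.eigenvector_of_resolvent (hres x₀ ⟨u, hu⟩)).1).smul hrd

end IsRegularPair

end RankOneTwist

/-! ### The phase of the parameter and the normalised eigenfunctions -/

section Lift

variable {H : Type*} [NormedAddCommGroup H] [InnerProductSpace ℂ H] [CompleteSpace H]

namespace IsRegularPair

variable {U : H →L[ℂ] H} {p : H} (h : IsRegularPair U p)

include h in
theorem norm_pos : 0 < ‖p‖ := norm_pos_iff.mpr h.ne_zero

/-- The derivative of the phase function. -/
def density (x : ℝ) : ℝ := ‖p‖ ^ 2 * ‖h.vec x‖ ^ 2 / (Real.pi * (1 + x ^ 2))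

theorem density_pos (x : ℝ) : 0 < h.density x := by
  have h1 := h.norm_pos
  have h2 := norm_pos_iff.mpr (h.vec_ne_zero x)
  have := Real.pi_pos
  unfold density
  positivity

theorem contDiff_density : ContDiff ℝ ∞ h.density := by
  unfold density
  refine (contDiff_const.mul (h.contDiff_vec.norm_sq ℂ)).div
    (contDiff_const.mul (contDiff_const.add (contDiff_id.pow 2))) fun x => ?_
  have := Real.pi_pos
  positivity

theorem hasDerivAt_param (x : ℝ) :
    HasDerivAt h.param (2 * Real.pi * Complex.I * h.density x * h.param x) x := by
  have hpar : h.param x * starRingEnd ℂ (h.param x) = 1 := by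
    rw [Complex.mul_conj', h.norm_param]; norm_num
  -- `inner_vec_vec` solved for `param y`. The last factor vanishes at `y = x`, so only its
  -- derivative contributes.
  have heq : h.param = fun y => h.param x * (1 +
      (⟪h.vec x, h.vec y⟫_ℂ * (‖p‖ : ℂ) ^ 2) *
        (starRingEnd ℂ (circlePoint x) * circlePoint y - 1)) := by
    funext y
    linear_combination (-h.param x) * h.inner_vec_vec x y - h.param y * hpar
  have hG : DifferentiableAt ℝ (fun y => ⟪h.vec x, h.vec y⟫_ℂ * (‖p‖ : ℂ) ^ 2) x := by
    have h1 : ContDiff ℝ ∞ fun y => ⟪h.vec x, h.vec y⟫_ℂ := contDiff_const.inner ℂ h.contDiff_vec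
    exact ((h1.differentiable (by simp)) x).mul_const _
  have hB := ((hasDerivAt_circlePoint x).const_mul (starRingEnd ℂ (circlePoint x))).sub_const 1
  have h2 := ((hG.hasDerivAt.mul hB).const_add 1).const_mul (h.param x)
  rw [heq]
  convert! h2 using 1
  simp only [conj_mul_circlePoint, sub_self, mul_zero, add_zero, mul_one, zero_add]
  rw [inner_self_eq_norm_sq_to_K, conj_circlePoint]
  have h3 := add_I_ne_zero x
  have h4 := sub_I_ne_zero x
  have h5 : (1 + (x : ℂ) ^ 2) ≠ 0 := by
    have : (1 + x ^ 2 : ℝ) ≠ 0 := by positivity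
    exact_mod_cast this
  have h6 : ((x : ℂ) - Complex.I) * ((x : ℂ) + Complex.I) = 1 + (x : ℂ) ^ 2 := by
    linear_combination -Complex.I_sq
  have h7 : ((x : ℂ) + Complex.I) / ((x : ℂ) - Complex.I) *
      (2 * Complex.I / ((x : ℂ) + Complex.I) ^ 2) = 2 * Complex.I / (1 + (x : ℂ) ^ 2) := by
    rw [← h6]
    field_simp
  rw [h7]
  have hpi : (Real.pi : ℂ) ≠ 0 := by exact_mod_cast Real.pi_ne_zero
  simp only [density, Complex.coe_algebraMap]
  push_cast
  field_simp

/-- A continuous lift of `param` along `s ↦ exp (2 π i s)`. -/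
def lift (x : ℝ) : ℝ :=
  (h.param 0).arg / (2 * Real.pi) + ∫ s in (0 : ℝ)..x, h.density s

theorem hasDerivAt_lift (x : ℝ) : HasDerivAt h.lift (h.density x) x := by
  have h1 := (h.contDiff_density.continuous.integral_hasStrictDerivAt 0 x).hasDerivAt
  exact h1.const_add _

theorem contDiff_lift : ContDiff ℝ ∞ h.lift := by
  rw [contDiff_infty_iff_deriv]
  refine ⟨fun x => (h.hasDerivAt_lift x).differentiableAt, ?_⟩
  rw [show deriv h.lift = h.density from funext fun x => (h.hasDerivAt_lift x).deriv]
  exact h.contDiff_density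

theorem strictMono_lift : StrictMono h.lift :=
  strictMono_of_deriv_pos fun x => by
    rw [(h.hasDerivAt_lift x).deriv]
    exact h.density_pos x

/-- Both sides solve the same linear differential equation, and the constant in `lift` matches them
at `0`. -/
theorem param_eq_exp_lift (x : ℝ) :
    h.param x = Complex.exp (2 * Real.pi * Complex.I * h.lift x) := by
  set g : ℝ → ℂ := fun x => h.param x * Complex.exp (-(2 * Real.pi * Complex.I * h.lift x)) with hg
  have hd : ∀ x, HasDerivAt g 0 x := by
    intro x
    have h1 := ((((h.hasDerivAt_lift x).ofReal_comp).const_mul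
      (2 * Real.pi * Complex.I)).neg).cexp
    have h2 := (h.hasDerivAt_param x).mul h1
    convert! h2 using 1
    ring
  have hconst := is_const_of_deriv_eq_zero (fun x => (hd x).differentiableAt)
    (fun x => (hd x).deriv) x 0
  have h0 : g 0 = 1 := by
    have h1 : h.lift 0 = (h.param 0).arg / (2 * Real.pi) := by simp [lift]
    have h2 : (2 * Real.pi * Complex.I * (h.lift 0 : ℝ) : ℂ) = (h.param 0).arg * Complex.I := by
      rw [h1]
      have hpi : (Real.pi : ℂ) ≠ 0 := by exact_mod_cast Real.pi_ne_zero
      push_cast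
      field_simp
    have h3 := Complex.norm_mul_exp_arg_mul_I (h.param 0)
    rw [h.norm_param, Complex.ofReal_one, one_mul] at h3
    simp only [hg]
    rw [h2]
    nth_rewrite 1 [← h3]
    rw [← Complex.exp_add, add_neg_cancel, Complex.exp_zero]
  rw [h0] at hconst
  simp only [hg, Complex.exp_neg] at hconst
  exact (mul_inv_eq_one₀ (Complex.exp_ne_zero _)).mp hconst

/-- The factor that turns `vec` into normalized eigenvectors with a real kernel. -/
def factor (x : ℝ) : ℂ :=
  Complex.exp (-(Real.pi * Complex.I * h.lift x)) * ((x : ℂ) + Complex.I)⁻¹ *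
    ((‖p‖ / (√Real.pi * √(h.density x)) : ℝ) : ℂ)

theorem factor_ne_zero (x : ℝ) : h.factor x ≠ 0 := by
  have h1 := h.norm_pos
  have h2 := Real.sqrt_pos.mpr (h.density_pos x)
  have h3 := Real.sqrt_pos.mpr Real.pi_pos
  have h4 : ‖p‖ / (√Real.pi * √(h.density x)) ≠ 0 := by positivity
  exact mul_ne_zero (mul_ne_zero (Complex.exp_ne_zero _) (inv_ne_zero (add_I_ne_zero x)))
    (by exact_mod_cast h4)

theorem conj_factor (x : ℝ) : starRingEnd ℂ (h.factor x) =
    Complex.exp (Real.pi * Complex.I * h.lift x) * ((x : ℂ) - Complex.I)⁻¹ *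
    ((‖p‖ / (√Real.pi * √(h.density x)) : ℝ) : ℂ) := by
  simp only [factor, map_mul, map_inv₀, map_add, Complex.conj_ofReal, Complex.conj_I,
    ← Complex.exp_conj, map_neg, sub_eq_add_neg]
  congr 3
  ring_nf

/-- The normalized eigenvector for the eigenvalue `x`. -/
def eigenfunction (x : ℝ) : H := h.factor x • h.vec x

theorem contDiff_eigenfunction : ContDiff ℝ ∞ h.eigenfunction := by
  have h1 : ContDiff ℝ ∞ fun x : ℝ => Complex.exp (-(Real.pi * Complex.I * h.lift x)) :=
    ((contDiff_const.mul (Complex.ofRealCLM.contDiff.comp h.contDiff_lift)).neg).cexp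
  have h2 : ContDiff ℝ ∞ fun x : ℝ => ((x : ℂ) + Complex.I)⁻¹ :=
    (Complex.ofRealCLM.contDiff.add contDiff_const).inv add_I_ne_zero
  have h3 : ContDiff ℝ ∞ fun x : ℝ => ‖p‖ / (√Real.pi * √(h.density x)) := by
    refine contDiff_const.div (contDiff_const.mul
      (h.contDiff_density.sqrt fun x => (h.density_pos x).ne')) fun x => ?_
    exact mul_ne_zero (Real.sqrt_pos.mpr Real.pi_pos).ne'
      (Real.sqrt_pos.mpr (h.density_pos x)).ne'
  exact ((h1.mul h2).mul (Complex.ofRealCLM.contDiff.comp h3)).smul h.contDiff_vec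

theorem norm_eigenfunction (x : ℝ) : ‖h.eigenfunction x‖ = 1 := by
  have hn := h.norm_ne_zero
  have hv := norm_pos_iff.mpr (h.vec_ne_zero x)
  have h1 : ‖h.factor x‖ ^ 2 = 1 / ‖h.vec x‖ ^ 2 := by
    have h2 := Real.sqrt_pos.mpr (h.density_pos x)
    have h3 := Real.sqrt_pos.mpr Real.pi_pos
    have h4 : ‖((x : ℂ) + Complex.I)‖ ^ 2 = 1 + x ^ 2 := by
      rw [← Complex.normSq_eq_norm_sq, Complex.normSq_apply]
      simp
      ring
    have h5 : ‖Complex.exp (-(Real.pi * Complex.I * h.lift x))‖ = 1 := by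
      rw [Complex.norm_exp]
      simp
    have hp := h.norm_pos
    have hpi := Real.pi_pos
    rw [factor, norm_mul, norm_mul, h5, norm_inv, one_mul, mul_pow, inv_pow, h4,
      Complex.norm_real, Real.norm_eq_abs, sq_abs, div_pow, mul_pow, Real.sq_sqrt hpi.le,
      Real.sq_sqrt (h.density_pos x).le, density]
    have h6 : (0 : ℝ) < 1 + x ^ 2 := by positivity
    field_simp
  have h2 : ‖h.eigenfunction x‖ ^ 2 = 1 := by
    rw [eigenfunction, norm_smul, mul_pow, h1]
    field_simp
  exact (pow_eq_one_iff_of_nonneg (norm_nonneg _) two_ne_zero).mp h2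

theorem eigenfunction_ne_zero (x : ℝ) : h.eigenfunction x ≠ 0 := by
  rw [← norm_ne_zero_iff, h.norm_eigenfunction]
  exact one_ne_zero

theorem twist_eigenfunction (x : ℝ) :
    twist U p (h.param x) (h.eigenfunction x) = circlePoint x • h.eigenfunction x := by
  rw [eigenfunction, map_smul, h.twist_vec, smul_comm]

theorem eq_smul_eigenfunction {a : ℂ} {x : ℝ} {v : H} (hv : twist U p a v = circlePoint x • v) :
    v = (⟪p, v⟫_ℂ / h.factor x) • h.eigenfunction x := by
  rw [eigenfunction, smul_smul, div_mul_cancel₀ _ (h.factor_ne_zero x)]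
  exact h.eq_smul_vec hv

/-- The half phases in `factor` turn `e^{2iα} - 1` into a multiple of `sin α`, and its `(x + i)⁻¹`
cancels the denominators from the Cayley points; what is left is real. -/
theorem inner_eigenfunction (x y : ℝ) :
    ⟪h.eigenfunction x, h.eigenfunction y⟫_ℂ *
      ((Real.pi * (y - x) * (√(h.density x) * √(h.density y)) : ℝ) : ℂ) =
      (Real.sin (Real.pi * (h.lift y - h.lift x)) : ℝ) := by
  have hn := h.norm_ne_zero
  have h1 := h.inner_vec_vec x y
  rw [conj_circlePoint_mul_sub_one, h.param_eq_exp_lift, h.param_eq_exp_lift] at h1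
  have hpi : ((√Real.pi : ℝ) : ℂ) ≠ 0 := by
    exact_mod_cast (Real.sqrt_pos.mpr Real.pi_pos).ne'
  have hpi2 : (Real.pi : ℂ) = ((√Real.pi : ℝ) : ℂ) ^ 2 := by
    exact_mod_cast (Real.sq_sqrt Real.pi_pos.le).symm
  have hwx : ((√(h.density x) : ℝ) : ℂ) ≠ 0 := by
    exact_mod_cast (Real.sqrt_pos.mpr (h.density_pos x)).ne'
  have hwy : ((√(h.density y) : ℝ) : ℂ) ≠ 0 := by
    exact_mod_cast (Real.sqrt_pos.mpr (h.density_pos y)).ne'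
  have hx := sub_I_ne_zero x
  have hy := add_I_ne_zero y
  set X : ℂ := Complex.exp (Real.pi * Complex.I * h.lift x) with hX
  set Y : ℂ := Complex.exp (Real.pi * Complex.I * h.lift y) with hY
  have hX0 : X ≠ 0 := Complex.exp_ne_zero _
  have hY0 : Y ≠ 0 := Complex.exp_ne_zero _
  have hcx : starRingEnd ℂ (Complex.exp (2 * Real.pi * Complex.I * h.lift x)) = (X ^ 2)⁻¹ := by
    rw [← Complex.exp_conj, hX, ← Complex.exp_nat_mul, ← Complex.exp_neg]
    congr 1
    simp only [map_mul, Complex.conj_ofReal, Complex.conj_I, map_ofNat]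
    push_cast
    ring
  have hcy : Complex.exp (2 * Real.pi * Complex.I * h.lift y) = Y ^ 2 := by
    rw [hY, ← Complex.exp_nat_mul]
    congr 1
    push_cast
    ring
  have hsin : ((Real.sin (Real.pi * (h.lift y - h.lift x)) : ℝ) : ℂ) =
      (X / Y - Y / X) * Complex.I / 2 := by
    rw [Complex.ofReal_sin, Complex.sin, hX, hY, ← Complex.exp_sub, ← Complex.exp_sub]
    push_cast
    ring_nf
  rw [hcx, hcy] at h1
  rw [hsin, eigenfunction, eigenfunction, inner_smul_left, inner_smul_right, conj_factor, factor,
    Complex.exp_neg, ← hX, ← hY]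
  push_cast
  rw [hpi2]
  field_simp
  field_simp at h1
  linear_combination (-Complex.I) * h1 + 2 * X ^ 2 * (‖p‖ : ℂ) ^ 2 *
    ⟪h.vec x, h.vec y⟫_ℂ * (y - x) * Complex.I_sq

theorem inner_eigenfunction_eq_div {x y : ℝ} (hxy : x ≠ y) :
    ⟪h.eigenfunction x, h.eigenfunction y⟫_ℂ =
      ((Real.sin (Real.pi * (h.lift y - h.lift x)) /
        (Real.pi * (y - x) * (√(h.density x) * √(h.density y))) : ℝ) : ℂ) := by
  have h1 := h.inner_eigenfunction x y
  have h2 : Real.pi * (y - x) * (√(h.density x) * √(h.density y)) ≠ 0 :=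
    mul_ne_zero (mul_ne_zero Real.pi_ne_zero (sub_ne_zero.mpr hxy.symm))
      (mul_ne_zero (Real.sqrt_pos.mpr (h.density_pos x)).ne'
        (Real.sqrt_pos.mpr (h.density_pos y)).ne')
  rw [Complex.ofReal_div, eq_div_iff (by exact_mod_cast h2)]
  exact h1

theorem inner_eigenfunction_im (x y : ℝ) :
    (⟪h.eigenfunction x, h.eigenfunction y⟫_ℂ).im = 0 := by
  by_cases hxy : x = y
  · subst hxy
    exact inner_self_im (𝕜 := ℂ) (h.eigenfunction x)
  · rw [h.inner_eigenfunction_eq_div hxy, Complex.ofReal_im]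

theorem twist_apply_eq_self_of_orthogonal {a : ℂ} (ha : ‖a‖ = 1) {E : Set H}
    (hE : ∀ x, a = h.param x → h.eigenfunction x ∈ E) {v : H} (hv : v ∈ (Submodule.span ℂ E)ᗮ) :
    twist U p a v = v := by
  refine apply_eq_self_of_orthogonal_eigenvectors (h.twist_mem_unitary ha) (innerSL ℂ p)
    (h.twist_bound a) fun x k hk => ?_
  by_cases h0 : k = 0
  · rw [h0, inner_zero_left]
  rw [h.eq_smul_eigenfunction hk, inner_smul_left,
    (Submodule.mem_orthogonal _ _).mp hv _ (Submodule.subset_span (hE x (h.param_eq hk h0))),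
    mul_zero]

theorem mem_range_one_sub_twist (x : ℝ) :
    h.eigenfunction x ∈ LinearMap.range (1 - twist U p (h.param x)).toLinearMap := by
  have h1 : 1 - circlePoint x ≠ 0 := sub_ne_zero.mpr (circlePoint_ne_one x).symm
  refine ⟨(1 - circlePoint x)⁻¹ • h.eigenfunction x, ?_⟩
  rw [map_smul, inv_smul_eq_iff₀ h1, sub_smul, one_smul, ← h.twist_eigenfunction]
  rfl

/-- The eigenvectors span a dense subspace of the closure of the range of `1 - W`. -/
theorem topologicalClosure_span_eq {a : ℂ} (ha : ‖a‖ = 1) {E : Set H}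
    (hE : ∀ v, v ∈ E ↔ ∃ x, a = h.param x ∧ h.eigenfunction x = v) :
    (Submodule.span ℂ E).topologicalClosure =
      (LinearMap.range (1 - twist U p a).toLinearMap).topologicalClosure := by
  apply le_antisymm
  · apply Submodule.topologicalClosure_mono
    rw [Submodule.span_le]
    intro v hv
    obtain ⟨x, rfl, rfl⟩ := (hE v).mp hv
    exact h.mem_range_one_sub_twist x
  · apply Submodule.topologicalClosure_minimal _ _ (Submodule.isClosed_topologicalClosure _)
    rw [← Submodule.orthogonal_orthogonal_eq_closure]
    rintro _ ⟨y, rfl⟩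
    rw [Submodule.mem_orthogonal]
    intro v hv
    -- A vector orthogonal to all of `E` is fixed by the unitary twist `W`, hence orthogonal to `ran
    -- (1 - W)`.
    have h1 := h.twist_apply_eq_self_of_orthogonal ha (fun x hx => (hE _).mpr ⟨x, hx, rfl⟩) hv
    have h2 := ContinuousLinearMap.inner_map_map_of_mem_unitary (h.twist_mem_unitary ha) v y
    rw [h1] at h2
    change ⟪v, y - twist U p a y⟫_ℂ = 0
    rw [inner_sub_right, h2, sub_self]

end IsRegularPair

end Lift

/-! ### From the symmetric transformation to a regular pair -/

section CayleyTransform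

variable {H : Type*} [NormedAddCommGroup H] [InnerProductSpace ℂ H]

theorem subScalar_apply (T : H →ₗ.[ℂ] H) (z : ℂ) (x : T.domain) :
    subScalar T z x = T x - z • (x : H) := rfl

theorem mem_defectSpace_I {T : H →ₗ.[ℂ] H} {v : H} : v ∈ defectSpace T Complex.I ↔
    v ∈ (LinearMap.range (subScalar T (-Complex.I)))ᗮ := by
  rw [defectSpace, Complex.conj_I]

theorem mem_defectSpace_neg_I {T : H →ₗ.[ℂ] H} {v : H} : v ∈ defectSpace T (-Complex.I) ↔
    v ∈ (LinearMap.range (subScalar T Complex.I))ᗮ := by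
  rw [defectSpace, map_neg, Complex.conj_I, neg_neg]

variable [CompleteSpace H]

theorem cayley_subScalar {T : H →ₗ.[ℂ] H} (hT : IsSR T) (x : T.domain) :
    cayley hT (subScalar T (-Complex.I) x) = subScalar T Complex.I x := by
  have := completeSpace_range hT
  have h1 : (LinearMap.range (subScalar T (-Complex.I))).orthogonalProjectionOnto
      (subScalar T (-Complex.I) x) = rangeEquiv hT x :=
    Submodule.orthogonalProjectionOnto_mem_subspace_eq_self (rangeEquiv hT x)
  change cayleyIsometry hT ((LinearMap.range (subScalar T (-Complex.I))).orthogonalProjectionOnto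
      (subScalar T (-Complex.I) x)) = _
  rw [h1]
  change subScalar T Complex.I ((rangeEquiv hT).symm (rangeEquiv hT x)) = _
  rw [LinearEquiv.symm_apply_apply]

theorem cayley_eq_zero {T : H →ₗ.[ℂ] H} (hT : IsSR T) {v : H}
    (hv : v ∈ defectSpace T Complex.I) : cayley hT v = 0 := by
  have := completeSpace_range hT
  change cayleyIsometry hT
    ((LinearMap.range (subScalar T (-Complex.I))).orthogonalProjectionOnto v) = _
  rw [Submodule.orthogonalProjectionOnto_eq_zero_iff.mpr (mem_defectSpace_I.mp hv), map_zero]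

/-- `ran (T + i)` is closed and its complement is the line through `p`. -/
theorem exists_subScalar_eq {T : H →ₗ.[ℂ] H} (hT : IsSR T) {p : H}
    (hp : p ∈ defectSpace T Complex.I) (hp0 : p ≠ 0) {v : H} (hv : ⟪p, v⟫_ℂ = 0) :
    ∃ x : T.domain, subScalar T (-Complex.I) x = v := by
  have := completeSpace_range hT
  change v ∈ LinearMap.range (subScalar T (-Complex.I))
  rw [← Submodule.orthogonal_orthogonal (LinearMap.range (subScalar T (-Complex.I))),
    Submodule.mem_orthogonal]
  intro u hu
  obtain ⟨c, hc⟩ := (finrank_eq_one_iff_of_nonzero' (⟨p, hp⟩ : defectSpace T Complex.I)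
    (fun h0 => hp0 (congrArg Subtype.val h0))).mp hT.index_plus ⟨u, mem_defectSpace_I.mpr hu⟩
  have hc' : c • p = u := congrArg Subtype.val hc
  rw [← hc', inner_smul_left, hv, mul_zero]

section Extension

variable {T : H →ₗ.[ℂ] H} (hT : IsSR T) {φp φm : H}

theorem unitaryExtension_apply (θ : ℝ) (v : H) : unitaryExtension hT φp φm θ v =
    cayley hT v +
      (Complex.exp (2 * Real.pi * Complex.I * θ) / (‖φp‖ : ℂ) ^ 2 * ⟪φp, v⟫_ℂ) • φm := by
  simp [unitaryExtension, smul_smul]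

theorem unitaryExtension_apply_of_inner_eq_zero (θ : ℝ) (x : T.domain)
    (hx : ⟪φp, subScalar T (-Complex.I) x⟫_ℂ = 0) :
    unitaryExtension hT φp φm θ (subScalar T (-Complex.I) x) = subScalar T Complex.I x := by
  rw [unitaryExtension_apply, hx, mul_zero, zero_smul, add_zero, cayley_subScalar]

variable (hp : φp ∈ defectSpace T Complex.I) (hm : φm ∈ defectSpace T (-Complex.I))
  (hp0 : φp ≠ 0) (hnorm : ‖φp‖ = ‖φm‖)

omit [CompleteSpace H] in
include hp in
theorem inner_subScalar_neg_I (x : T.domain) : ⟪φp, subScalar T (-Complex.I) x⟫_ℂ = 0 :=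
  inner_eq_zero_symm.mp ((Submodule.mem_orthogonal _ _).mp (mem_defectSpace_I.mp hp) _ ⟨x, rfl⟩)

include hp hp0 in
theorem unitaryExtension_apply_self (θ : ℝ) : unitaryExtension hT φp φm θ φp =
    Complex.exp (2 * Real.pi * Complex.I * θ) • φm := by
  have hn : (‖φp‖ : ℂ) ≠ 0 := by exact_mod_cast norm_ne_zero_iff.mpr hp0
  rw [unitaryExtension_apply, cayley_eq_zero hT hp, zero_add, inner_self_eq_norm_sq_to_K]
  congr 1
  simp only [Complex.coe_algebraMap]
  field_simp

include hp hp0 in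
theorem unitaryExtension_zero_apply_self : unitaryExtension hT φp φm 0 φp = φm := by
  rw [unitaryExtension_apply_self hT hp hp0]
  simp

include hp hp0 in
theorem unitaryExtension_eq_twist (θ : ℝ) : unitaryExtension hT φp φm θ =
    twist (unitaryExtension hT φp φm 0) φp (Complex.exp (2 * Real.pi * Complex.I * θ)) := by
  ext v
  rw [twist_apply, unitaryExtension_zero_apply_self hT hp hp0, unitaryExtension_apply,
    unitaryExtension_apply, add_assoc, ← add_smul]
  congr 2
  simp
  ring

include hp hm hp0 hnorm in
-- Isometric by Pythagoras, since `ran (T + i) ⊕ ℂ φ₊` goes to `ran (T - i) ⊕ ℂ φ₋`. Its range is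
-- closed, and a vector orthogonal to it is a multiple of `φ₋`, which itself lies in the range.
theorem unitaryExtension_zero_mem_unitary :
    unitaryExtension hT φp φm 0 ∈ unitary (H →L[ℂ] H) := by
  have hn : (‖φp‖ : ℂ) ≠ 0 := by exact_mod_cast norm_ne_zero_iff.mpr hp0
  have hiso : ∀ v, ‖unitaryExtension hT φp φm 0 v‖ = ‖v‖ := by
    intro v
    set c := ⟪φp, v⟫_ℂ / (‖φp‖ : ℂ) ^ 2 with hc
    have hy : ⟪φp, v - c • φp⟫_ℂ = 0 := by
      rw [inner_sub_right, inner_smul_right, inner_self_eq_norm_sq_to_K, hc]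
      simp only [Complex.coe_algebraMap]
      field_simp
      ring
    obtain ⟨x, hx⟩ := exists_subScalar_eq hT hp hp0 hy
    have hv : v = subScalar T (-Complex.I) x + c • φp := by rw [hx, sub_add_cancel]
    have hUv : unitaryExtension hT φp φm 0 v = subScalar T Complex.I x + c • φm := by
      rw [hv, map_add, map_smul, unitaryExtension_zero_apply_self hT hp hp0,
        unitaryExtension_apply_of_inner_eq_zero hT 0 x (inner_subScalar_neg_I hp x)]
    have h1 : ⟪subScalar T Complex.I x, c • φm⟫_ℂ = 0 := by
      rw [inner_smul_right, (Submodule.mem_orthogonal _ _).mp (mem_defectSpace_neg_I.mp hm) _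
        ⟨x, rfl⟩, mul_zero]
    have h2 : ⟪subScalar T (-Complex.I) x, c • φp⟫_ℂ = 0 := by
      rw [inner_smul_right, inner_eq_zero_symm.mp (inner_subScalar_neg_I hp x), mul_zero]
    have h3 := norm_add_sq_eq_norm_sq_add_norm_sq_of_inner_eq_zero _ _ h1
    have h4 := norm_add_sq_eq_norm_sq_add_norm_sq_of_inner_eq_zero _ _ h2
    have h5 := norm_sq_subScalar hT.symmetric (Or.inl rfl) x
    have h6 := norm_sq_subScalar hT.symmetric (Or.inr rfl) x
    rw [← hUv, norm_smul, ← hnorm] at h3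
    rw [← hv, norm_smul] at h4
    exact (sq_eq_sq₀ (norm_nonneg _) (norm_nonneg _)).mp (by nlinarith)
  refine mem_unitary_of_norm_map hiso ?_
  set U := unitaryExtension hT φp φm 0 with hU
  have hanti : AntilipschitzWith 1 U :=
    U.antilipschitz_of_bound fun v => by rw [hiso]; simp
  have hclosed : IsClosed (LinearMap.range U.toLinearMap : Set H) :=
    hanti.isClosed_range U.uniformContinuous
  have : CompleteSpace (LinearMap.range U.toLinearMap) := hclosed.completeSpace_coe
  refine LinearMap.range_eq_top.mp (Submodule.orthogonal_eq_bot_iff.mp ?_)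
  rw [eq_bot_iff]
  intro k hk
  rw [Submodule.mem_orthogonal] at hk
  have hk' : k ∈ defectSpace T (-Complex.I) := by
    rw [mem_defectSpace_neg_I, Submodule.mem_orthogonal]
    rintro _ ⟨x, rfl⟩
    refine hk _ ⟨subScalar T (-Complex.I) x, ?_⟩
    exact unitaryExtension_apply_of_inner_eq_zero hT 0 x (inner_subScalar_neg_I hp x)
  have hm0 : φm ≠ 0 := by
    rw [← norm_ne_zero_iff, ← hnorm]
    exact norm_ne_zero_iff.mpr hp0
  obtain ⟨c, hc⟩ := (finrank_eq_one_iff_of_nonzero' (⟨φm, hm⟩ : defectSpace T (-Complex.I))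
    (fun h0 => hm0 (congrArg Subtype.val h0))).mp hT.index_minus ⟨k, hk'⟩
  have hc' : c • φm = k := congrArg Subtype.val hc
  have h1 := hk φm ⟨φp, unitaryExtension_zero_apply_self hT hp hp0⟩
  rw [← hc', inner_smul_right, mul_eq_zero, inner_self_eq_zero] at h1
  rw [Submodule.mem_bot, ← hc', h1.resolve_right hm0, zero_smul]

theorem one_sub_circlePoint (x : ℝ) : 1 - circlePoint x = 2 * Complex.I / ((x : ℂ) + Complex.I) := by
  have := add_I_ne_zero x
  rw [circlePoint]
  field_simp
  ring

theorem one_add_circlePoint (x : ℝ) : 1 + circlePoint x = 2 * x / ((x : ℂ) + Complex.I) := by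
  have := add_I_ne_zero x
  rw [circlePoint]
  field_simp
  ring

include hp hm hp0 hnorm in
theorem isRegularPair : IsRegularPair (unitaryExtension hT φp φm 0) φp where
  mem_unitary := unitaryExtension_zero_mem_unitary hT hp hm hp0 hnorm
  ne_zero := hp0
  bound := by
    intro t
    obtain ⟨c, hc, hb⟩ := hT.regular t
    have hd : 0 < ‖1 - circlePoint t‖ :=
      norm_pos_iff.mpr (sub_ne_zero.mpr (circlePoint_ne_one t).symm)
    -- The numerator comes from `(U - b(t)) (T + i) x = (1 - b(t)) (T - t) x`, the denominator from
    -- `(T + i) x = (T - t) x + (t + i) x` and regularity.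
    refine ⟨‖1 - circlePoint t‖ / (1 + (|t| + 1) / c), by positivity, fun v hv => ?_⟩
    obtain ⟨x, rfl⟩ := exists_subScalar_eq hT hp hp0 hv
    rw [unitaryExtension_apply_of_inner_eq_zero hT 0 x hv]
    have h1 : subScalar T Complex.I x - circlePoint t • subScalar T (-Complex.I) x =
        (1 - circlePoint t) • subScalar T (t : ℂ) x := by
      have h2 : (1 + circlePoint t) * Complex.I = (1 - circlePoint t) * t := by
        rw [one_sub_circlePoint, one_add_circlePoint]
        ring
      have h3 : subScalar T Complex.I x - circlePoint t • subScalar T (-Complex.I) x =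
          (1 - circlePoint t) • T x - ((1 + circlePoint t) * Complex.I) • (x : H) := by
        simp only [subScalar_apply]
        module
      rw [h3, h2, subScalar_apply]
      module
    have h2 : ‖subScalar T (-Complex.I) x‖ ≤
        (1 + (|t| + 1) / c) * ‖subScalar T (t : ℂ) x‖ := by
      have h3 : subScalar T (-Complex.I) x =
          subScalar T (t : ℂ) x + ((t : ℂ) + Complex.I) • (x : H) := by
        simp only [subScalar_apply]
        module
      have h4 : ‖(t : ℂ) + Complex.I‖ ≤ |t| + 1 := by
        refine (norm_add_le _ _).trans ?_
        simp
      have h5 : ‖(x : H)‖ ≤ ‖subScalar T (t : ℂ) x‖ / c := by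
        rw [le_div_iff₀ hc, mul_comm]
        exact hb x
      calc ‖subScalar T (-Complex.I) x‖
          ≤ ‖subScalar T (t : ℂ) x‖ + ‖(t : ℂ) + Complex.I‖ * ‖(x : H)‖ := by
            rw [h3, ← norm_smul]
            exact norm_add_le _ _
        _ ≤ ‖subScalar T (t : ℂ) x‖ + (|t| + 1) * (‖subScalar T (t : ℂ) x‖ / c) := by
            gcongr
        _ = _ := by ring
    rw [h1, norm_smul, div_mul_eq_mul_div, div_le_iff₀ (by positivity)]
    calc _ ≤ ‖1 - circlePoint t‖ * ((1 + (|t| + 1) / c) * ‖subScalar T (t : ℂ) x‖) := by gcongr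
      _ = _ := by ring

end Extension

omit [CompleteSpace H] in
theorem bijective_inverseCayley_iff {W : H →L[ℂ] H} (z : ℂ) :
    Function.Bijective
        (fun q : inverseCayley W => (q : H × H).2 - z • (q : H × H).1) ↔
      Function.Bijective (fun y : H => (Complex.I - z) • y + (Complex.I + z) • W y) := by
  set Φ := ((1 - W).prod (Complex.I • (1 + W))).toLinearMap with hΦ
  have hΦv : ∀ y, Φ y = (y - W y, Complex.I • (y + W y)) := fun y => rfl
  have hinj : Function.Injective Φ := by
    rw [injective_iff_map_eq_zero]
    intro y hy
    rw [hΦv, Prod.mk_eq_zero, smul_eq_zero, or_iff_right Complex.I_ne_zero] at hy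
    have h1 : (2 : ℂ) • y = 0 := by
      rw [two_smul]
      have := congrArg₂ (· + ·) hy.1 hy.2
      simpa using this
    simpa using h1
  have hbij : Function.Bijective Φ.rangeRestrict :=
    ⟨fun a b hab => hinj (congrArg Subtype.val hab), LinearMap.surjective_rangeRestrict Φ⟩
  refine (Function.Bijective.of_comp_iff
    (fun q : inverseCayley W => (q : H × H).2 - z • (q : H × H).1) hbij).symm.trans ?_
  have heq : (fun q : inverseCayley W => (q : H × H).2 - z • (q : H × H).1) ∘ Φ.rangeRestrict =
      fun y : H => (Complex.I - z) • y + (Complex.I + z) • W y := by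
    funext y
    change Complex.I • (y + W y) - z • (y - W y) = _
    module
  exact iff_of_eq (congrArg Function.Bijective heq)

namespace IsRegularPair

variable {U : H →L[ℂ] H} {p : H} (h : IsRegularPair U p)

/-- Away from `z = -i` the question is whether `b(z)` lies in the spectrum of the twist. As `b(z) ≠
1`, an eigenvalue `1`, the multivalued part of the relation, never contributes. -/
theorem mem_graphSpectrum_iff {a : ℂ} (ha : ‖a‖ = 1) (z : ℂ) :
    z ∈ graphSpectrum (inverseCayley (twist U p a)) ↔ ∃ x : ℝ, z = x ∧ a = h.param x := by
  rw [graphSpectrum, Set.mem_ofPred_eq, bijective_inverseCayley_iff]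
  constructor
  · intro hz
    -- At the pole `z = -i` of `b` the map is multiplication by `2i`.
    by_cases hzI : Complex.I + z = 0
    · refine absurd ?_ hz
      have h1 : Complex.I - z = 2 * Complex.I := by linear_combination -hzI
      have h2 : (2 * Complex.I) ≠ 0 := mul_ne_zero two_ne_zero Complex.I_ne_zero
      simp only [hzI, zero_smul, add_zero, h1]
      exact (MulAction.bijective₀ h2 : Function.Bijective fun y : H => (2 * Complex.I) • y)
    set w := (z - Complex.I) / (Complex.I + z) with hw
    have hfac : (fun y : H => (Complex.I - z) • y + (Complex.I + z) • twist U p a y) =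
        (fun y : H => (Complex.I + z) • y) ∘ (twist U p a - w • (1 : H →L[ℂ] H)) := by
      funext y
      change _ = (Complex.I + z) • (twist U p a y - w • y)
      have h1 : (Complex.I + z) * w = z - Complex.I := by rw [hw]; field_simp
      rw [smul_sub, smul_smul, h1]
      module
    have hnot : ¬ IsUnit (twist U p a - w • (1 : H →L[ℂ] H)) := by
      intro hu
      apply hz
      rw [hfac]
      exact (MulAction.bijective₀ hzI).comp (ContinuousLinearMap.isUnit_iff_bijective.mp hu)
    have hspec : w ∈ spectrum ℂ (twist U p a) := by
      rw [spectrum.mem_iff, Algebra.algebraMap_eq_smul_one]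
      intro hu
      apply hnot
      have h1 := hu.neg
      rwa [neg_sub] at h1
    have hw1 : w ≠ 1 := by
      rw [hw, Ne, div_eq_one_iff_eq hzI]
      intro h0
      have h1 : (2 : ℂ) * Complex.I = 0 := by linear_combination -h0
      simp at h1
    obtain ⟨x, hx⟩ := exists_circlePoint (mem_sphere_zero_iff_norm.mp
      (spectrum.subset_circle_of_unitary (h.twist_mem_unitary ha) hspec)) hw1
    refine ⟨x, ?_, ?_⟩
    · rw [hw, circlePoint, div_eq_div_iff (add_I_ne_zero x) hzI] at hx
      have h1 : (2 * Complex.I) * (z - x) = 0 := by linear_combination -hx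
      simpa [sub_eq_zero] using h1
    · by_contra hax
      apply hnot
      rw [← hx]
      refine h.isUnit_twist_sub ha fun v hv => ?_
      by_contra h0
      exact hax (h.param_eq hv h0)
  · rintro ⟨x, rfl, rfl⟩ hbij
    have h1 := h.twist_eigenfunction x
    apply h.eigenfunction_ne_zero x
    apply hbij.injective
    simp only [h1, smul_zero, map_zero, add_zero, smul_smul, ← add_smul]
    have h2 : (Complex.I + (x : ℂ)) * circlePoint x = x - Complex.I := by
      rw [add_comm, circlePoint, mul_div_cancel₀ _ (add_I_ne_zero x)]
    rw [h2]
    simp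

theorem mem_inverseCayley (x : ℝ) :
    (h.eigenfunction x, (x : ℂ) • h.eigenfunction x) ∈
      inverseCayley (twist U p (h.param x)) := by
  have h0 : 1 - circlePoint x ≠ 0 := sub_ne_zero.mpr (circlePoint_ne_one x).symm
  refine ⟨(1 - circlePoint x)⁻¹ • h.eigenfunction x, ?_⟩
  change ((1 - circlePoint x)⁻¹ • h.eigenfunction x -
      twist U p (h.param x) ((1 - circlePoint x)⁻¹ • h.eigenfunction x),
    Complex.I • ((1 - circlePoint x)⁻¹ • h.eigenfunction x +
      twist U p (h.param x) ((1 - circlePoint x)⁻¹ • h.eigenfunction x))) = _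
  rw [map_smul, h.twist_eigenfunction, ← smul_sub, ← smul_add, Prod.mk.injEq]
  constructor
  · rw [inv_smul_eq_iff₀ h0]
    module
  · have h1 : Complex.I * ((1 - circlePoint x)⁻¹ * (1 + circlePoint x)) = x := by
      have := add_I_ne_zero x
      rw [one_sub_circlePoint, one_add_circlePoint]
      have := Complex.I_ne_zero
      field_simp
    rw [← h1]
    module

end IsRegularPair

omit [CompleteSpace H] in
theorem map_fst_inverseCayley (W : H →L[ℂ] H) :
    (inverseCayley W).map (LinearMap.fst ℂ H H) = LinearMap.range (1 - W).toLinearMap := by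
  rw [inverseCayley, ← LinearMap.range_comp]
  rfl

end CayleyTransform

/-! ### Spectral functions, eigenbases and the kernel formula -/

section SpectralFunction

variable {H : Type*} [NormedAddCommGroup H] [InnerProductSpace ℂ H] [CompleteSpace H]

theorem norm_exp_two_pi_mul_I (θ : ℝ) : ‖Complex.exp (2 * Real.pi * Complex.I * θ)‖ = 1 := by
  rw [Complex.norm_exp]
  simp

namespace IsRegularPair

variable {U : H →L[ℂ] H} {p : H} (h : IsRegularPair U p)

theorem exp_eq_param_iff (θ x : ℝ) :
    Complex.exp (2 * Real.pi * Complex.I * θ) = h.param x ↔ ∃ n : ℤ, h.lift x = n + θ := by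
  rw [h.param_eq_exp_lift, eq_comm, Complex.exp_eq_exp_iff_exists_int]
  refine exists_congr fun n => ?_
  have h0 : (2 * Real.pi * Complex.I : ℂ) ≠ 0 := Complex.two_pi_I_ne_zero
  rw [show (2 * Real.pi * Complex.I * θ + n * (2 * Real.pi * Complex.I) : ℂ) =
    2 * Real.pi * Complex.I * ((n + θ : ℝ) : ℂ) by push_cast; ring, mul_right_inj' h0]
  exact Complex.ofReal_inj

end IsRegularPair

theorem graphSpectrum_saExtension {T : H →ₗ.[ℂ] H} (hT : IsSR T) {φp φm : H}
    (hp : φp ∈ defectSpace T Complex.I) (hp0 : φp ≠ 0)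
    (h : IsRegularPair (unitaryExtension hT φp φm 0) φp) (θ : ℝ) (z : ℂ) :
    z ∈ graphSpectrum (saExtension hT φp φm θ) ↔
      ∃ x : ℝ, z = x ∧ ∃ n : ℤ, h.lift x = n + θ := by
  rw [saExtension, unitaryExtension_eq_twist hT hp hp0,
    h.mem_graphSpectrum_iff (norm_exp_two_pi_mul_I θ)]
  simp only [h.exp_eq_param_iff]

theorem exists_isSpectralFunction {T : H →ₗ.[ℂ] H} (hT : IsSR T) {φp φm : H}
    (hp : φp ∈ defectSpace T Complex.I) (hp0 : φp ≠ 0)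
    (h : IsRegularPair (unitaryExtension hT φp φm 0) φp) :
    ∃ (J : Set ℝ) (t : ℝ → ℝ), IsSpectralFunction hT φp φm J t := by
  have hleft : Function.LeftInverse (Function.invFun h.lift) h.lift :=
    Function.leftInverse_invFun h.strictMono_lift.injective
  refine ⟨Set.range h.lift, Function.invFun h.lift, ?_, ?_, ⟨fun _ _ => Set.mem_univ _, ?_, ?_⟩, ?_⟩
  · exact (isPreconnected_range h.contDiff_lift.continuous).ordConnected
  · rintro _ ⟨x, rfl⟩ _ ⟨y, rfl⟩ hxy
    rw [hleft, hleft]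
    exact h.strictMono_lift.lt_iff_lt.mp hxy
  · rintro _ ⟨x, rfl⟩ _ ⟨y, rfl⟩ hxy
    rw [hleft, hleft] at hxy
    rw [hxy]
  · exact fun x _ => ⟨h.lift x, ⟨x, rfl⟩, hleft x⟩
  · intro θ _
    ext z
    rw [graphSpectrum_saExtension hT hp hp0 h]
    constructor
    · rintro ⟨x, rfl, n, hn⟩
      exact ⟨n, ⟨x, hn⟩, by rw [← hn, hleft]⟩
    · rintro ⟨n, ⟨x, hn⟩, rfl⟩
      exact ⟨x, by rw [← hn, hleft], n, hn⟩

namespace IsSpectralFunction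

variable {T : H →ₗ.[ℂ] H} {hT : IsSR T} {φp φm : H} {J : Set ℝ} {t : ℝ → ℝ}
  (hs : IsSpectralFunction hT φp φm J t)

section Phase

include hs

theorem phase_mem (x : ℝ) : phase J t x ∈ J :=
  hs.bijOn.surjOn.mapsTo_invFunOn (Set.mem_univ x)

theorem apply_phase (x : ℝ) : t (phase J t x) = x :=
  hs.bijOn.surjOn.rightInvOn_invFunOn (Set.mem_univ x)

theorem phase_apply {s : ℝ} (hsJ : s ∈ J) : phase J t (t s) = s :=
  hs.bijOn.injOn (hs.phase_mem _) hsJ (hs.apply_phase _)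

theorem strictMono_phase : StrictMono (phase J t) := by
  intro x y hxy
  rw [← hs.strictMonoOn.lt_iff_lt (hs.phase_mem x) (hs.phase_mem y), hs.apply_phase,
    hs.apply_phase]
  exact hxy

/-- A strictly increasing bijection of `ℝ` onto an interval is an order isomorphism, hence a
homeomorphism. -/
theorem continuous_phase : Continuous (phase J t) := by
  have : J.OrdConnected := hs.ordConnected
  let g : ℝ → J := fun x => ⟨phase J t x, hs.phase_mem x⟩
  have hg : StrictMono g := fun x y hxy => hs.strictMono_phase hxy
  have hgs : Function.Surjective g := fun s => ⟨t s, Subtype.ext (hs.phase_apply s.2)⟩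
  exact continuous_subtype_val.comp (hg.orderIsoOfSurjective g hgs).continuous

/-- `J` is open because, like `ℝ`, it has neither a least nor a greatest element. -/
theorem mem_nhds {s : ℝ} (hsJ : s ∈ J) : J ∈ nhds s := by
  have h1 : phase J t (t s - 1) < s := by
    conv_rhs => rw [← hs.phase_apply hsJ]
    exact hs.strictMono_phase (by linarith)
  have h2 : s < phase J t (t s + 1) := by
    conv_lhs => rw [← hs.phase_apply hsJ]
    exact hs.strictMono_phase (by linarith)
  exact Filter.mem_of_superset (Icc_mem_nhds h1 h2)
    (hs.ordConnected.out (hs.phase_mem _) (hs.phase_mem _))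

theorem continuousAt {s : ℝ} (hsJ : s ∈ J) : ContinuousAt t s := by
  refine hs.strictMonoOn.continuousAt_of_image_mem_nhds (hs.mem_nhds hsJ) ?_
  rw [hs.bijOn.image_eq]
  exact Filter.univ_mem

end Phase

variable (h : IsRegularPair (unitaryExtension hT φp φm 0) φp)

include hs

/-- Any phase function differs from the canonical one by an integer constant. -/
theorem exists_lift_eq_phase_add (hp : φp ∈ defectSpace T Complex.I) (hp0 : φp ≠ 0) :
    ∃ N : ℤ, ∀ x, h.lift x = phase J t x + N := by
  have h1 : ∀ x, ∃ n : ℤ, (n : ℝ) = h.lift x - phase J t x := by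
    intro x
    have h2 : (x : ℂ) ∈ graphSpectrum (saExtension hT φp φm (Int.fract (phase J t x))) := by
      rw [hs.spectrum _ ⟨Int.fract_nonneg _, Int.fract_lt_one _⟩]
      refine ⟨⌊phase J t x⌋, ?_, ?_⟩
      · rw [Int.floor_add_fract]
        exact hs.phase_mem x
      · rw [Int.floor_add_fract, hs.apply_phase]
    rw [graphSpectrum_saExtension hT hp hp0 h] at h2
    obtain ⟨y, hy, n, hn⟩ := h2
    obtain rfl : x = y := Complex.ofReal_inj.mp hy
    refine ⟨n - ⌊phase J t x⌋, ?_⟩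
    rw [hn]
    push_cast
    linarith [Int.floor_add_fract (phase J t x)]
  choose d hd using h1
  -- An integer-valued continuous function on `ℝ` is constant.
  have hcont : Continuous d := by
    rw [Int.isClosedEmbedding_coe_real.isEmbedding.continuous_iff]
    rw [show ((↑) : ℤ → ℝ) ∘ d = fun x => h.lift x - phase J t x from funext hd]
    exact h.contDiff_lift.continuous.sub hs.continuous_phase
  refine ⟨d 0, fun x => ?_⟩
  rw [PreconnectedSpace.constant inferInstance hcont (x := 0) (y := x), hd]
  ring

theorem hasDerivAt (hp : φp ∈ defectSpace T Complex.I) (hp0 : φp ≠ 0) {s : ℝ} (hsJ : s ∈ J) :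
    HasDerivAt t (h.density (t s))⁻¹ s := by
  obtain ⟨N, hN⟩ := hs.exists_lift_eq_phase_add h hp hp0
  have h1 : HasDerivAt (phase J t) (h.density (t s)) (t s) := by
    rw [show phase J t = fun x => h.lift x - N from funext fun x => by rw [hN]; ring]
    exact (h.hasDerivAt_lift (t s)).sub_const _
  refine h1.of_local_left_inverse (hs.continuousAt hsJ) (h.density_pos _).ne' ?_
  filter_upwards [hs.mem_nhds hsJ] with u hu
  exact hs.phase_apply hu

theorem exp_eq_param (hp : φp ∈ defectSpace T Complex.I) (hp0 : φp ≠ 0) {θ : ℝ} {n : ℤ}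
    (hn : (n : ℝ) + θ ∈ J) :
    Complex.exp (2 * Real.pi * Complex.I * θ) = h.param (t (n + θ)) := by
  obtain ⟨N, hN⟩ := hs.exists_lift_eq_phase_add h hp hp0
  rw [h.exp_eq_param_iff]
  refine ⟨n + N, ?_⟩
  rw [hN, hs.phase_apply hn]
  push_cast
  ring

theorem inner_eigenfunction_eq_zero (hp : φp ∈ defectSpace T Complex.I) (hp0 : φp ≠ 0) {s s' : ℝ}
    (hsJ : s ∈ J) (hsJ' : s' ∈ J) {n : ℤ} (hn : s' - s = n) (hne : s ≠ s') :
    ⟪h.eigenfunction (t s), h.eigenfunction (t s')⟫_ℂ = 0 := by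
  obtain ⟨N, hN⟩ := hs.exists_lift_eq_phase_add h hp hp0
  rw [h.inner_eigenfunction_eq_div fun h0 => hne (hs.bijOn.injOn hsJ hsJ' h0), hN, hN,
    hs.phase_apply hsJ, hs.phase_apply hsJ', add_sub_add_right_eq_sub, hn, mul_comm,
    Real.sin_int_mul_pi, zero_div, Complex.ofReal_zero]

theorem orthonormal_eigenfunction (hp : φp ∈ defectSpace T Complex.I) (hp0 : φp ≠ 0) (θ : ℝ)
    {s : Set ℤ} (hsJ : ∀ n ∈ s, (n : ℝ) + θ ∈ J) :
    Orthonormal ℂ (fun n : s => h.eigenfunction (t ((n : ℤ) + θ))) := by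
  refine ⟨fun n => h.norm_eigenfunction _, fun n m hnm => ?_⟩
  refine hs.inner_eigenfunction_eq_zero h hp hp0 (hsJ n n.2) (hsJ m m.2)
    (n := (m : ℤ) - (n : ℤ)) (by push_cast; ring) fun h0 => hnm ?_
  exact Subtype.ext (by exact_mod_cast add_right_cancel h0)

theorem mem_range_eigenfunction_iff (hp : φp ∈ defectSpace T Complex.I) (hp0 : φp ≠ 0) (θ : ℝ)
    {s : Set ℤ} (hsJ : ∀ n, n ∈ s ↔ (n : ℝ) + θ ∈ J) (v : H) :
    v ∈ Set.range (fun n : s => h.eigenfunction (t ((n : ℤ) + θ))) ↔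
      ∃ x, Complex.exp (2 * Real.pi * Complex.I * θ) = h.param x ∧ h.eigenfunction x = v := by
  constructor
  · rintro ⟨n, rfl⟩
    exact ⟨_, hs.exp_eq_param h hp hp0 ((hsJ n).mp n.2), rfl⟩
  · rintro ⟨x, hx, rfl⟩
    obtain ⟨N, hN⟩ := hs.exists_lift_eq_phase_add h hp hp0
    obtain ⟨n, hn⟩ := (h.exp_eq_param_iff θ x).mp hx
    have h1 : ((n - N : ℤ) : ℝ) + θ = phase J t x := by
      push_cast
      linarith [hN x]
    refine ⟨⟨n - N, (hsJ _).mpr (h1 ▸ hs.phase_mem x)⟩, ?_⟩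
    change h.eigenfunction (t (((n - N : ℤ) : ℝ) + θ)) = _
    rw [h1, hs.apply_phase]

/-- The eigenbases built from the normalized eigenvectors. -/
theorem isOrthonormalEigenbasis (hp : φp ∈ defectSpace T Complex.I) (hp0 : φp ≠ 0) (θ : ℝ) :
    IsOrthonormalEigenbasis hT φp φm J t θ
      (fun n => h.eigenfunction (t (n + θ))) where
  orthonormal := hs.orthonormal_eigenfunction h hp hp0 θ (s := {n : ℤ | (n : ℝ) + θ ∈ J})
    fun n hn => hn
  eigenvector n hn := by
    rw [saExtension, unitaryExtension_eq_twist hT hp hp0, hs.exp_eq_param h hp hp0 hn]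
    exact h.mem_inverseCayley _
  complete := by
    have h1 := h.topologicalClosure_span_eq (norm_exp_two_pi_mul_I θ)
      (hs.mem_range_eigenfunction_iff h hp hp0 θ (s := {n : ℤ | (n : ℝ) + θ ∈ J}) fun n => Iff.rfl)
    rw [← unitaryExtension_eq_twist hT hp hp0] at h1
    rw [saExtension, map_fst_inverseCayley]
    exact h1

/-- With this choice the bases for all `θ` are samples of one smooth curve, so the kernel is smooth
across the points `t_k` as well. -/
theorem eigenvectorAt_eq (x : ℝ) :
    eigenvectorAt J t (fun θ n => h.eigenfunction (t (n + θ))) x = h.eigenfunction x := by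
  rw [eigenvectorAt, Int.floor_add_fract, hs.apply_phase]

theorem kernel_eq (x y : ℝ) :
    kernel J t (fun θ n => h.eigenfunction (t (n + θ))) x y =
      ⟪h.eigenfunction x, h.eigenfunction y⟫_ℂ := by
  rw [kernel, hs.eigenvectorAt_eq h, hs.eigenvectorAt_eq h]

end IsSpectralFunction

theorem neg_one_zpow_mul_self (k : ℤ) : (-1 : ℝ) ^ k * (-1 : ℝ) ^ k = 1 := by
  rw [← mul_zpow]
  simp

theorem sin_pi_eq_neg_one_zpow_mul (s : ℝ) :
    Real.sin (Real.pi * s) = (-1 : ℝ) ^ ⌊s⌋ * Real.sin (Real.pi * Int.fract s) := by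
  have h1 : Real.pi * s = Real.pi * Int.fract s + ⌊s⌋ * Real.pi := by
    nth_rewrite 1 [← Int.fract_add_floor s]
    ring
  rw [h1, Real.sin_add_int_mul_pi]

theorem sin_pi_fract_pos {s : ℝ} (hs : ∀ k : ℤ, s ≠ k) : 0 < Real.sin (Real.pi * Int.fract s) := by
  have h0 : 0 < Int.fract s := Int.fract_pos.mpr (hs _)
  have hpi := Real.pi_pos
  refine Real.sin_pos_of_pos_of_lt_pi (by positivity) ?_
  nlinarith [Int.fract_lt_one s]

namespace IsSpectralFunction

variable {T : H →ₗ.[ℂ] H} {hT : IsSR T} {φp φm : H} {J : Set ℝ} {t : ℝ → ℝ}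
  (hs : IsSpectralFunction hT φp φm J t) (h : IsRegularPair (unitaryExtension hT φp φm 0) φp)

include hs

theorem inner_eigenfunction_index (hp : φp ∈ defectSpace T Complex.I) (hp0 : φp ≠ 0) {x : ℝ}
    (k : Index J) (hx : x ≠ t (k : ℤ)) :
    ⟪h.eigenfunction x, h.eigenfunction (t (k : ℤ))⟫_ℂ =
      ((Real.sin (Real.pi * phase J t x) / (Real.pi * √(h.density x)) *
        ((-1 : ℝ) ^ (k : ℤ) / (√(h.density (t (k : ℤ))) * (x - t (k : ℤ)))) : ℝ) : ℂ) := by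
  obtain ⟨N, hN⟩ := hs.exists_lift_eq_phase_add h hp hp0
  rw [h.inner_eigenfunction_eq_div hx, hN, hN, hs.phase_apply k.2, add_sub_add_right_eq_sub]
  congr 1
  have h1 : Real.sin (Real.pi * (((k : ℤ) : ℝ) - phase J t x)) =
      -((-1 : ℝ) ^ (k : ℤ) * Real.sin (Real.pi * phase J t x)) := by
    rw [show Real.pi * (((k : ℤ) : ℝ) - phase J t x) =
      -(Real.pi * phase J t x) + (k : ℤ) * Real.pi by ring, Real.sin_add_int_mul_pi, Real.sin_neg]
    ring
  have h2 : x - t (k : ℤ) ≠ 0 := sub_ne_zero.mpr hx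
  have h3 : t (k : ℤ) - x ≠ 0 := sub_ne_zero.mpr hx.symm
  have h4 := (Real.sqrt_pos.mpr (h.density_pos x)).ne'
  have h5 := (Real.sqrt_pos.mpr (h.density_pos (t (k : ℤ)))).ne'
  have hpi := Real.pi_ne_zero
  rw [h1]
  field_simp
  ring

/-- The expansion of the kernel in the eigenbasis of `T_0`. -/
theorem hasSum_kernel (hp : φp ∈ defectSpace T Complex.I) (hp0 : φp ≠ 0)
    (hinv : ∀ v : H, unitaryExtension hT φp φm 0 v = v → v = 0) {x y : ℝ}
    (hx : ∀ k : Index J, x ≠ t (k : ℤ)) (hy : ∀ k : Index J, y ≠ t (k : ℤ)) :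
    ∃ K : ℝ, ⟪h.eigenfunction x, h.eigenfunction y⟫_ℂ = K ∧
      HasSum (fun k : Index J => Real.sin (Real.pi * phase J t x) / (Real.pi * √(h.density x)) *
        (Real.sin (Real.pi * phase J t y) / (Real.pi * √(h.density y))) *
        (deriv t (k : ℤ) / ((x - t (k : ℤ)) * (y - t (k : ℤ))))) K := by
  have hO := hs.orthonormal_eigenfunction h hp hp0 0 (s := {k : ℤ | (k : ℝ) ∈ J})
    fun n hn => by simpa using hn
  have hE := hs.mem_range_eigenfunction_iff h hp hp0 0 (s := {k : ℤ | (k : ℝ) ∈ J})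
    fun n => by simp
  -- A vector orthogonal to the eigenvectors is fixed by `U_0`, and `1` is not an eigenvalue.
  have hdense : (Submodule.span ℂ (Set.range
      (fun n : {k : ℤ | (k : ℝ) ∈ J} => h.eigenfunction (t ((n : ℤ) + 0)))))ᗮ = ⊥ := by
    rw [eq_bot_iff]
    intro v hv
    have h1 := h.twist_apply_eq_self_of_orthogonal (norm_exp_two_pi_mul_I 0)
      (fun x hx => (hE _).mpr ⟨x, hx, rfl⟩) hv
    rw [← unitaryExtension_eq_twist hT hp hp0] at h1
    exact hinv v h1
  have hsum := (HilbertBasis.mkOfOrthogonalEqBot hO hdense).hasSum_inner_mul_inner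
    (h.eigenfunction x) (h.eigenfunction y)
  have hK := Complex.ext (z := ⟪h.eigenfunction x, h.eigenfunction y⟫_ℂ)
    (w := ((⟪h.eigenfunction x, h.eigenfunction y⟫_ℂ).re : ℂ)) rfl
    (by rw [h.inner_eigenfunction_im, Complex.ofReal_im])
  refine ⟨_, hK, ?_⟩
  rw [← Complex.hasSum_ofReal, ← hK]
  convert! hsum using 1
  funext k
  have hb : HilbertBasis.mkOfOrthogonalEqBot hO hdense k = h.eigenfunction (t (k : ℤ)) := by
    rw [HilbertBasis.coe_mkOfOrthogonalEqBot, add_zero]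
  rw [hb, ← inner_conj_symm _ (h.eigenfunction y), hs.inner_eigenfunction_index h hp hp0 k (hx k),
    hs.inner_eigenfunction_index h hp hp0 k (hy k), Complex.conj_ofReal, ← Complex.ofReal_mul,
    (hs.hasDerivAt h hp hp0 k.2).deriv]
  congr 1
  have h1 := neg_one_zpow_mul_self k
  have h2 : (h.density (t (k : ℤ)))⁻¹ =
      (√(h.density (t (k : ℤ))))⁻¹ * (√(h.density (t (k : ℤ))))⁻¹ := by
    rw [← mul_inv, Real.mul_self_sqrt (h.density_pos _).le]
  rw [h2]
  simp only [div_eq_mul_inv, mul_inv]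
  linear_combination (-(Real.sin (Real.pi * phase J t x) * Real.sin (Real.pi * phase J t y) *
    Real.pi⁻¹ ^ 2 * (√(h.density x))⁻¹ * (√(h.density y))⁻¹ * (√(h.density (t (k : ℤ))))⁻¹ ^ 2 *
    (x - t (k : ℤ))⁻¹ * (y - t (k : ℤ))⁻¹)) * h1

theorem phase_ne_int {x : ℝ} (hx : ∀ k : Index J, x ≠ t (k : ℤ)) (k : ℤ) : phase J t x ≠ k := by
  intro hk
  refine hx ⟨k, hk ▸ hs.phase_mem x⟩ ?_
  rw [← hk, hs.apply_phase]

/-- The expansion at `x = y` sums to `‖φ_x‖² = 1`, which determines the weight up to sign. -/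
theorem weight_eq (hp : φp ∈ defectSpace T Complex.I) (hp0 : φp ≠ 0)
    (hinv : ∀ v : H, unitaryExtension hT φp φm 0 v = v → v = 0) {x : ℝ}
    (hx : ∀ k : Index J, x ≠ t (k : ℤ)) :
    (Summable fun k : Index J => deriv t (k : ℤ) / (x - t (k : ℤ)) ^ 2) ∧
      weight J t x = Real.sin (Real.pi * Int.fract (phase J t x)) /
        (Real.pi * √(h.density x)) := by
  obtain ⟨K, hK, hsum⟩ := hs.hasSum_kernel h hp hp0 hinv hx hx
  have hpos : 0 < Real.sin (Real.pi * Int.fract (phase J t x)) / (Real.pi * √(h.density x)) :=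
    div_pos (sin_pi_fract_pos (hs.phase_ne_int hx))
      (mul_pos Real.pi_pos (Real.sqrt_pos.mpr (h.density_pos x)))
  set u := Real.sin (Real.pi * Int.fract (phase J t x)) / (Real.pi * √(h.density x)) with hu
  -- Splitting off `(-1)^⌊τ(x)⌋` leaves the positive number `u`, the right root to take for the
  -- power `-1/2`.
  have hg : Real.sin (Real.pi * phase J t x) / (Real.pi * √(h.density x)) =
      (-1 : ℝ) ^ ⌊phase J t x⌋ * u := by
    rw [sin_pi_eq_neg_one_zpow_mul, hu, mul_div_assoc]
  have hK1 : K = 1 := by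
    rw [inner_self_eq_norm_sq_to_K, h.norm_eigenfunction] at hK
    have h1 : ((1 : ℝ) : ℂ) = K := by simpa using hK
    exact (Complex.ofReal_inj.mp h1).symm
  have h2 : (-1 : ℝ) ^ ⌊phase J t x⌋ * u * ((-1 : ℝ) ^ ⌊phase J t x⌋ * u) = u ^ 2 := by
    linear_combination u ^ 2 * neg_one_zpow_mul_self ⌊phase J t x⌋
  rw [hg, hK1, h2] at hsum
  have h3 := hsum.mul_left (u ^ 2)⁻¹
  simp only [inv_mul_cancel_left₀ (pow_ne_zero 2 hpos.ne'), mul_one, ← sq] at h3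
  refine ⟨h3.summable, ?_⟩
  rw [weight, h3.tsum_eq, ← Real.rpow_natCast, ← Real.rpow_neg hpos.le, ← Real.rpow_mul hpos.le]
  norm_num

theorem kernel_formula (hp : φp ∈ defectSpace T Complex.I) (hp0 : φp ≠ 0)
    (hinv : ∀ v : H, unitaryExtension hT φp φm 0 v = v → v = 0) {x y : ℝ}
    (hxy : ∀ k : Index J, x ≠ t (k : ℤ) ∧ y ≠ t (k : ℤ)) :
    (Summable fun k : Index J => deriv t (k : ℤ) / (x - t (k : ℤ)) ^ 2) ∧
    (Summable fun k : Index J => deriv t (k : ℤ) / ((x - t (k : ℤ)) * (y - t (k : ℤ)))) ∧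
    ⟪h.eigenfunction x, h.eigenfunction y⟫_ℂ =
      ((weight J t x * (-1 : ℝ) ^ ⌊phase J t x⌋ *
        (∑' k : Index J, deriv t (k : ℤ) / ((x - t (k : ℤ)) * (y - t (k : ℤ)))) *
        (-1 : ℝ) ^ ⌊phase J t y⌋ * weight J t y : ℝ) : ℂ) := by
  obtain ⟨hsx, hwx⟩ := hs.weight_eq h hp hp0 hinv fun k => (hxy k).1
  obtain ⟨-, hwy⟩ := hs.weight_eq h hp hp0 hinv fun k => (hxy k).2
  obtain ⟨K, hK, hsum⟩ := hs.hasSum_kernel h hp hp0 hinv (fun k => (hxy k).1) fun k => (hxy k).2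
  have hg : ∀ z, (∀ k : Index J, z ≠ t (k : ℤ)) →
      Real.sin (Real.pi * phase J t z) / (Real.pi * √(h.density z)) ≠ 0 := by
    intro z hz
    rw [sin_pi_eq_neg_one_zpow_mul]
    exact div_ne_zero (mul_ne_zero (zpow_ne_zero _ (by norm_num))
      (sin_pi_fract_pos (hs.phase_ne_int hz)).ne')
      (mul_pos Real.pi_pos (Real.sqrt_pos.mpr (h.density_pos z))).ne'
  have hS : Summable fun k : Index J =>
      deriv t (k : ℤ) / ((x - t (k : ℤ)) * (y - t (k : ℤ))) :=
    (summable_mul_left_iff (mul_ne_zero (hg x fun k => (hxy k).1)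
      (hg y fun k => (hxy k).2))).mp hsum.summable
  refine ⟨hsx, hS, ?_⟩
  rw [hK, ← hsum.tsum_eq, tsum_mul_left, hwx, hwy, sin_pi_eq_neg_one_zpow_mul (phase J t x),
    sin_pi_eq_neg_one_zpow_mul (phase J t y)]
  congr 1
  ring

end IsSpectralFunction

end SpectralFunction

end SymmetricExtension

end

theorem mainTheorem2 {H : Type*} [NormedAddCommGroup H] [InnerProductSpace ℂ H]
    [CompleteSpace H] [TopologicalSpace.SeparableSpace H]
    (T : H →ₗ.[ℂ] H) (hT : SymmetricExtension.IsSR T) (φp φm : H)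
    (hp : φp ∈ SymmetricExtension.defectSpace T Complex.I)
    (hm : φm ∈ SymmetricExtension.defectSpace T (-Complex.I))
    (hp0 : φp ≠ 0) (hnorm : ‖φp‖ = ‖φm‖) :
    (∃ (J : Set ℝ) (t : ℝ → ℝ), SymmetricExtension.IsSpectralFunction hT φp φm J t) ∧
    ∀ (J : Set ℝ) (t : ℝ → ℝ), SymmetricExtension.IsSpectralFunction hT φp φm J t →
      (∀ k : SymmetricExtension.Index J, DifferentiableAt ℝ t (k : ℤ)) ∧
      ∃ e : ℝ → ℤ → H,
        (∀ θ ∈ Set.Ico (0 : ℝ) 1,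
          SymmetricExtension.IsOrthonormalEigenbasis hT φp φm J t θ (e θ)) ∧
        ContDiff ℝ ∞ (fun p : ℝ × ℝ => SymmetricExtension.kernel J t e p.1 p.2) ∧
        (∀ x y : ℝ, (SymmetricExtension.kernel J t e x y).im = 0) ∧
        SymmetricExtension.IsPositiveKernel (SymmetricExtension.kernel J t e) ∧
        ((∀ v : H, SymmetricExtension.unitaryExtension hT φp φm 0 v = v → v = 0) →
          ∀ x y : ℝ, (∀ k : SymmetricExtension.Index J, x ≠ t (k : ℤ) ∧ y ≠ t (k : ℤ)) →
            (Summable fun k : SymmetricExtension.Index J =>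
              deriv t (k : ℤ) / (x - t (k : ℤ)) ^ 2) ∧
            (Summable fun k : SymmetricExtension.Index J =>
              deriv t (k : ℤ) / ((x - t (k : ℤ)) * (y - t (k : ℤ)))) ∧
            SymmetricExtension.kernel J t e x y =
              ((SymmetricExtension.weight J t x *
                (-1 : ℝ) ^ ⌊SymmetricExtension.phase J t x⌋ *
                (∑' k : SymmetricExtension.Index J,
                  deriv t (k : ℤ) / ((x - t (k : ℤ)) * (y - t (k : ℤ)))) *
                (-1 : ℝ) ^ ⌊SymmetricExtension.phase J t y⌋ *
                SymmetricExtension.weight J t y : ℝ) : ℂ)) := by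
  have h := SymmetricExtension.isRegularPair hT hp hm hp0 hnorm
  refine ⟨SymmetricExtension.exists_isSpectralFunction hT hp hp0 h, fun J t hs =>
    ⟨fun k => (hs.hasDerivAt h hp hp0 k.2).differentiableAt,
      -- Values with `n + θ ∉ J` are irrelevant: the kernel only reads at `τ(x) ∈ J`.
      fun θ n => h.eigenfunction (t (n + θ)),
      fun θ _ => hs.isOrthonormalEigenbasis h hp hp0 θ, ?_, ?_, ?_, ?_⟩⟩
  · simp only [hs.kernel_eq h]
    exact (h.contDiff_eigenfunction.comp contDiff_fst).inner ℂ
      (h.contDiff_eigenfunction.comp contDiff_snd)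
  · intro x y
    rw [hs.kernel_eq h]
    exact h.inner_eigenfunction_im x y
  · intro N x
    simp only [hs.kernel_eq h]
    exact Matrix.posSemidef_gram ℂ fun k => h.eigenfunction (x k)
  · intro hinv x y hxy
    rw [hs.kernel_eq h]
    exact hs.kernel_formula h hp hp0 hinv hxy
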